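/- Work in the upper half-space model of hyperbolic 3-space, $\mathbb H^3=\{(z,t): z\in\mathbb C=\mathbb R^2,\ t>0\}$, with projection $\pi(z,t)=z$. All horoballs below are based at points of $\mathbb R^2$: the (closed) horoball with center $b\in\mathbb R^2$ and radius $r>0$ is the Euclidean ball of radius $r$ resting on the boundary plane at $b$. It is *full-sized* if $r=1/2$ (equivalently, $\pi$ of it has radius $1/2$; equivalently, it is tangent to the horoball $\{t\ge 1\}$ at $\infty$) and *at most full-sized* if $r\le 1/2$. Two horoballs are *tangent* if they meet but their interiors are disjoint. A *$k$-necklace* ($k\ge 1$) is a family $N=(N_j)_{j\in\mathbb Z/k}$ of horoballs (*beads*) with pairwise disjoint interiors such that $N_j$ is tangent to $N_{j+1}$ for every $j$. Its *ties* are the hyperbolic geodesics joining the centers of consecutive beads; they project to the edges of the closed polygon through the centers of the beads. The necklace *encircles* a horoball $C$ if this closed polygon has non-zero winding number about the center of $C$. Let $C_1,C_2$ be full-sized horoballs with disjoint interiors and with centers $c_1,c_2$. Call a necklace *admissible* for $(C_1,C_2)$ if all its beads are at most full-sized and have interiors disjoint from those of $C_1$ and $C_2$, and it encircles both $C_1$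 and $C_2$. For $\theta\in\mathbb R$ let $\eta_\theta=(N_j^\theta)_{j\in\mathbb Z/8}$ be the family of full-sized horoballs with centers $$c_1+(c_2-c_1)e^{i(\theta+j\pi/3)}\quad(j=0,1,2,3),\qquad c_2+(c_2-c_1)e^{i(\theta+(j-1)\pi/3)}\quad(j=4,5,6,7).$$ When $C_1,C_2$ are tangent, as $\theta$ varies the bead $N_0^\theta$ slides along $C_1$; the remaining beads are then placed cyclically in turn, each touching $C_1$ or $C_2$. Then: 1. Every $k$-necklace admissible for $(C_1,C_2)$ has $k\ge 8$. 2. If $N$ is an admissible necklace with exactly $8$ beads, then $C_1$ and $C_2$ are tangent, every bead of $N$ is full-sized, every bead of $N$ is tangent to $C_1$ or to $C_2$, and there is $\theta\in[\pi/3,2\pi/3]$ such that $N$ is equal to $\eta_\theta$ up to a cyclic shift and possibly a reversal of the labels. 3. Conversely, if $C_1$ and $C_2$ are tangent, then $\eta_\theta$ is an admissible $8$-bead necklace for every $\theta\in[\pi/3,2\pi/3]$, so the minimum $8$ is attained; for different $\theta\in[\pi/3,2\pi/3)$ the necklaces $\eta_\theta$ have different sets of beads, so that they form a one-parameter family; and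 $\eta_{\pi/3}$ is the hexagonal configuration: its beads are exactly the horoballs other than $C_1,C_2$ that are tangent to $C_1$ or $C_2$ in the hexagonal packing of full-sized horoballs containing $C_1$ and $C_2$, that is, the packing with centers $c_1+(c_2-c_1)(m+ne^{i\pi/3})$, $m,n\in\mathbb Z$. -/

import Mathlib

/-- The upper half-space model of hyperbolic 3-space: points `(z, t)` with `z ∈ ℝ² = ℂ` and `t > 0`,
with the Euclidean topology. -/
abbrev HypSpace : Type := {p : ℂ × ℝ // 0 < p.2}

/-- The standard projection of the upper half-space to the plane. -/
def hypProj (p : HypSpace) : ℂ := p.1.1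

/-- A horoball based at a point `center` of the boundary plane.  In the upper half-space model it
is a Euclidean ball, of some radius, resting on the boundary plane at `center`. -/
@[ext]
structure Horoball where
  center : ℂ
  radius : ℝ
  radius_pos : 0 < radius

namespace Horoball

/-- The (closed) horoball as a subset of the upper half-space: the points whose Euclidean distance
from `(center, radius)` is at most `radius`. -/
def carrier (B : Horoball) : Set HypSpace :=
  {p | ‖p.1.1 - B.center‖ ^ 2 + (p.1.2 - B.radius) ^ 2 ≤ B.radius ^ 2}

/-- The projection of a horoball to the plane is the round disc with the same radius. -/
theorem hypProj_image_carrier (B : Horoball) :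
    hypProj '' B.carrier = Metric.closedBall B.center B.radius := by
  ext z
  simp only [Set.mem_image, Metric.mem_closedBall, dist_eq_norm]
  constructor
  · rintro ⟨p, hp, rfl⟩
    have h : ‖p.1.1 - B.center‖ ^ 2 + (p.1.2 - B.radius) ^ 2 ≤ B.radius ^ 2 := hp
    have h' : ‖p.1.1 - B.center‖ ^ 2 ≤ B.radius ^ 2 := by
      nlinarith [sq_nonneg (p.1.2 - B.radius)]
    exact (abs_le_of_sq_le_sq' h' B.radius_pos.le).2
  · intro hz
    refine ⟨⟨(z, B.radius), B.radius_pos⟩, ?_, rfl⟩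
    show ‖z - B.center‖ ^ 2 + (B.radius - B.radius) ^ 2 ≤ B.radius ^ 2
    have := norm_nonneg (z - B.center)
    nlinarith

/-- A horoball is full-sized if its projection to the plane has radius `1/2`. -/
def IsFull (B : Horoball) : Prop := B.radius = 1 / 2

/-- A horoball is at most full-sized if its projection to the plane has radius at most `1/2`. -/
def IsAtMostFull (B : Horoball) : Prop := B.radius ≤ 1 / 2

/-- Two horoballs have disjoint interiors. -/
def InteriorDisjoint (B B' : Horoball) : Prop :=
  Disjoint (interior B.carrier) (interior B'.carrier)

/-- Two horoballs are tangent: they meet, but their interiors do not. -/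
def Tangent (B B' : Horoball) : Prop :=
  (B.carrier ∩ B'.carrier).Nonempty ∧ B.InteriorDisjoint B'

/-- The full-sized horoball based at `c`. -/
noncomputable def full (c : ℂ) : Horoball := ⟨c, 1 / 2, by norm_num⟩

end Horoball

/-- A `k`-necklace: a cyclically ordered family of `k` horoballs with disjoint interiors, each
tangent to the next one. -/
structure IsNecklace {k : ℕ} (N : ZMod k → Horoball) : Prop where
  interiorDisjoint : ∀ i j, i ≠ j → (N i).InteriorDisjoint (N j)
  tangent_succ : ∀ i, (N i).Tangent (N (i + 1))

/-- The winding number about `c` of the projection of the closed curve formed by the ties of `N`.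
The tie from one bead to the next is the hyperbolic geodesic joining their centers; it projects to
the straight segment between the centers, so the projected curve is a closed polygon.  Its winding
number about a point off the polygon is the sum of the signed angles in `(-π, π)` that its edges
subtend at the point, divided by `2π`. -/
noncomputable def tieWinding {k : ℕ} [NeZero k] (N : ZMod k → Horoball) (c : ℂ) : ℝ :=
  (∑ i, Complex.arg (((N (i + 1)).center - c) / ((N i).center - c))) / (2 * Real.pi)

/-- The necklace `N` encircles `C`: the closed curve formed by its ties links the vertical geodesic
ending at the center of `C`, that is, its projection winds around the center of `C`. -/
def Encircles {k : ℕ} [NeZero k] (N : ZMod k → Horoball) (C : Horoball) : Prop :=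
  tieWinding N C.center ≠ 0

/-- `N` is a necklace of at most full-sized horoballs, with interiors disjoint from those of `C₁`
and `C₂`, that encircles both `C₁` and `C₂`. -/
structure IsEncirclingNecklace (C₁ C₂ : Horoball) {k : ℕ} [NeZero k] (N : ZMod k → Horoball) :
    Prop where
  isNecklace : IsNecklace N
  isAtMostFull : ∀ j, (N j).IsAtMostFull
  interiorDisjoint_left : ∀ j, (N j).InteriorDisjoint C₁
  interiorDisjoint_right : ∀ j, (N j).InteriorDisjoint C₂
  encircles_left : Encircles N C₁
  encircles_right : Encircles N C₂

/-- The members of the hexagonal packing by full-sized horoballs that has the tangent full-sized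
horoballs `C₁` and `C₂` among its members. -/
def hexPacking (C₁ C₂ : Horoball) : Set Horoball :=
  {B | ∃ m n : ℤ, B = Horoball.full (C₁.center + (C₂.center - C₁.center) *
    (m + n * Complex.exp ((Real.pi / 3 : ℝ) * Complex.I)))}

/-- The slid configuration around tangent full-sized horoballs `C₁`, `C₂`.  Bead `0` touches `C₁`
in the direction that makes the angle `θ` with the ray from the center of `C₁` to that of `C₂`.
The other full-sized beads are placed in turn: beads `0, 1, 2, 3` around `C₁`, each a turn of `π/3`
further than the one before, then bead `4` around `C₂` in the same direction as bead `3` around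
`C₁`, and beads `5, 6, 7` around `C₂` by further turns of `π/3`. -/
noncomputable def slidNecklace (C₁ C₂ : Horoball) (θ : ℝ) (j : ZMod 8) : Horoball :=
  Horoball.full
    (if j.val ≤ 3 then
      C₁.center + (C₂.center - C₁.center) *
        Complex.exp ((θ + j.val * (Real.pi / 3) : ℝ) * Complex.I)
    else
      C₂.center + (C₂.center - C₁.center) *
        Complex.exp ((θ + ((j.val : ℝ) - 1) * (Real.pi / 3) : ℝ) * Complex.I))

/-!
A horoball of radius `r` at `z` and a horoball of radius `r'` at `z'` have disjoint interiors if and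
only if `4 r r' ≤ ‖z - z'‖²`, and are tangent if and only if equality holds
(`Horoball.interiorDisjoint_iff`, `Horoball.tangent_iff`).  For an encircling necklace this makes
every tie a segment of length `ρ ≤ 1` that is not longer than any segment from one of its ends to a
center of `C₁` or `C₂`, and not longer than the segment between these two centers
(`IsEncirclingNecklace.isShortSegment`).  Hence the signed angles `α` and `β` that it subtends at the
two centers are at most `π / 3` in size.  More is true: `|α + β| ≤ π / 2`
(`IsShortSegment.abs_arg_add_arg_le`).  Indeed, if the centers are `±d` and the ends of the tie are
`x` and `y`, the claim is `‖x² - y²‖² ≤ ‖x² - d²‖² + ‖y² - d²‖²`; as `A B ≥ ρ² (A + B - ρ²)` for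
`A, B ≥ ρ²`, the parallelogram law bounds the right-hand side from below by
`ρ² (‖x + y‖² + 4 ‖d‖² - ρ²)`, and `ρ ≤ 2 ‖d‖`.

The sums of the `α` and of the `β` are non-zero multiples of `2π`.  With at most eight beads both are
`±2π`.  If the signs agree, `4π ≤ k π / 2`, so `k ≥ 8`.  Opposite signs are impossible for `k ≤ 8`
(`not_opposite_winding`): such a polygon would be a figure eight, and after crossing the segment
between the centers it would need more edges than there are to come back to it.

For `k = 8` all inequalities are equalities.  Then `C₁` and `C₂` are tangent, all beads are
full-sized and each bead touches `C₁` or `C₂`.  In the coordinate in which the centers are `0` and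
`1`, each vertex arises from the one before by a rotation by `π / 3` about `0` or `1` or by a
translation by `±1` (`IsTightOctagon.succ_left`, `IsTightOctagon.succ_right`), and following the
vertices from a translation by `-1` on leaves only the slid octagons
(`IsTightOctagon.exists_eq_slidPoint`).  Conversely, the slid octagons satisfy all distance
conditions, which reduce to inequalities between integers for vectors of the hexagonal lattice
(`IsSlidStart.isTightOctagon`).
-/

/-! ### Horoballs in coordinates -/

namespace Horoball

theorem mem_carrier {B : Horoball} {p : HypSpace} :
    p ∈ B.carrier ↔ ‖p.1.1 - B.center‖ ^ 2 + (p.1.2 - B.radius) ^ 2 ≤ B.radius ^ 2 := Iff.rfl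

/-- A point of the interior of a horoball lies strictly inside the Euclidean sphere: a point of the
sphere can be pushed radially outwards. -/
theorem lt_of_mem_interior {B : Horoball} {p : HypSpace} (hp : p ∈ interior B.carrier) :
    ‖p.1.1 - B.center‖ ^ 2 + (p.1.2 - B.radius) ^ 2 < B.radius ^ 2 := by
  have hmem : ‖p.1.1 - B.center‖ ^ 2 + (p.1.2 - B.radius) ^ 2 ≤ B.radius ^ 2 :=
    mem_carrier.mp (interior_subset hp)
  refine lt_of_le_of_ne hmem fun heq => ?_
  obtain ⟨O, hO, hpre⟩ := isOpen_induced_iff.mp (isOpen_interior (s := B.carrier))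
  let γ : ℝ → ℂ × ℝ := fun s =>
    (p.1.1 + (s : ℂ) * (p.1.1 - B.center), p.1.2 + s * (p.1.2 - B.radius))
  have hγ : Continuous γ := by fun_prop
  have h0 : γ 0 = p.1 := by ext <;> simp [γ]
  have hpO : γ 0 ∈ O := by
    rw [h0]
    have : p ∈ Subtype.val ⁻¹' O := by rw [hpre]; exact hp
    exact this
  have hpos : 0 < (γ 0).2 := by rw [h0]; exact p.2
  have e1 : ∀ᶠ s in nhds (0 : ℝ), γ s ∈ O := hγ.continuousAt (hO.mem_nhds hpO)
  have e2 : ∀ᶠ s in nhds (0 : ℝ), 0 < (γ s).2 :=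
    (continuous_snd.comp hγ).continuousAt (isOpen_Ioi.mem_nhds hpos)
  obtain ⟨s, ⟨hsO, hst⟩, hs⟩ :=
    (((e1.and e2).filter_mono nhdsWithin_le_nhds).and
      (self_mem_nhdsWithin : Set.Ioi (0 : ℝ) ∈ nhdsWithin 0 (Set.Ioi 0))).exists
  have hs : 0 < s := hs
  have hin : (⟨γ s, hst⟩ : HypSpace) ∈ interior B.carrier := by
    rw [← hpre]; exact hsO
  have hle : ‖(γ s).1 - B.center‖ ^ 2 + ((γ s).2 - B.radius) ^ 2 ≤ B.radius ^ 2 :=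
    mem_carrier.mp (interior_subset hin)
  have h1 : (γ s).1 - B.center = ((1 + s : ℝ) : ℂ) * (p.1.1 - B.center) := by
    simp only [γ]; push_cast; ring
  have h2 : (γ s).2 - B.radius = (1 + s) * (p.1.2 - B.radius) := by
    simp only [γ]; ring
  rw [h1, h2, norm_mul, Complex.norm_real, Real.norm_eq_abs, mul_pow, sq_abs, mul_pow,
    ← mul_add, heq] at hle
  have := B.radius_pos
  nlinarith [mul_pos hs (pow_pos this 2), mul_pos (mul_pos hs hs) (pow_pos this 2)]

theorem mem_interior_of_lt {B : Horoball} {p : HypSpace}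
    (hp : ‖p.1.1 - B.center‖ ^ 2 + (p.1.2 - B.radius) ^ 2 < B.radius ^ 2) :
    p ∈ interior B.carrier := by
  have hopen : IsOpen {p : HypSpace |
      ‖p.1.1 - B.center‖ ^ 2 + (p.1.2 - B.radius) ^ 2 < B.radius ^ 2} :=
    isOpen_lt (by fun_prop) continuous_const
  exact interior_maximal (fun q (hq : _ < _) => mem_carrier.mpr hq.le) hopen hp

/-- A common point of two horoballs bounds the distance of their centers. -/
theorem normSq_sub_le_of_mem_carrier {B B' : Horoball} {p : HypSpace}
    (h : p ∈ B.carrier) (h' : p ∈ B'.carrier) :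
    ‖B.center - B'.center‖ ^ 2 ≤ 4 * B.radius * B'.radius := by
  have h : ‖p.1.1 - B.center‖ ^ 2 + (p.1.2 - B.radius) ^ 2 ≤ B.radius ^ 2 := h
  have h' : ‖p.1.1 - B'.center‖ ^ 2 + (p.1.2 - B'.radius) ^ 2 ≤ B'.radius ^ 2 := h'
  have ht : 0 < p.1.2 := p.2
  have htri : ‖B.center - B'.center‖ ≤ ‖p.1.1 - B.center‖ + ‖p.1.1 - B'.center‖ := by
    have := norm_sub_le (p.1.1 - B'.center) (p.1.1 - B.center)
    rw [sub_sub_sub_cancel_left] at this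
    linarith
  set t := p.1.2
  set x := ‖p.1.1 - B.center‖
  set y := ‖p.1.1 - B'.center‖
  have hx : 0 ≤ x := norm_nonneg _
  have hy : 0 ≤ y := norm_nonneg _
  have hx2 : x ^ 2 ≤ t * (2 * B.radius - t) := by linarith
  have hy2 : y ^ 2 ≤ t * (2 * B'.radius - t) := by linarith
  have hA : 0 ≤ 2 * B.radius - t := nonneg_of_mul_nonneg_right (le_trans (sq_nonneg x) hx2) ht
  have hB : 0 ≤ 2 * B'.radius - t := nonneg_of_mul_nonneg_right (le_trans (sq_nonneg y) hy2) ht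
  have hxy : 2 * (x * y) ≤ (2 * B.radius - t) * (2 * B'.radius - t) + t ^ 2 := by
    have hm : x ^ 2 * y ^ 2 ≤ (t * (2 * B.radius - t)) * (t * (2 * B'.radius - t)) :=
      mul_le_mul hx2 hy2 (sq_nonneg y) (le_trans (sq_nonneg x) hx2)
    refine le_of_sq_le_sq ?_ (by positivity)
    nlinarith [sq_nonneg ((2 * B.radius - t) * (2 * B'.radius - t) - t ^ 2)]
  calc ‖B.center - B'.center‖ ^ 2 ≤ (x + y) ^ 2 :=
        pow_le_pow_left₀ (norm_nonneg _) htri 2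
    _ ≤ 4 * B.radius * B'.radius := by nlinarith

/-- The point that divides the segment between the Euclidean centers of two horoballs in the ratio
of their radii. -/
noncomputable def divisionPoint (B B' : Horoball) : HypSpace :=
  ⟨(B.center + ((B.radius / (B.radius + B'.radius) : ℝ) : ℂ) * (B'.center - B.center),
    2 * B.radius * B'.radius / (B.radius + B'.radius)), by
    have := B.radius_pos
    have := B'.radius_pos
    dsimp only
    positivity⟩

theorem divisionPoint_comm (B B' : Horoball) : divisionPoint B B' = divisionPoint B' B := by
  have h := B.radius_pos
  have h' := B'.radius_pos
  have h1 : (B.radius : ℂ) + B'.radius ≠ 0 := by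
    exact_mod_cast (add_pos h h').ne'
  have h2 : (B'.radius : ℂ) + B.radius ≠ 0 := by
    exact_mod_cast (add_pos h' h).ne'
  apply Subtype.ext
  refine Prod.ext ?_ ?_
  · simp only [divisionPoint]
    push_cast
    field_simp
    ring
  · simp only [divisionPoint]
    rw [add_comm B'.radius]
    ring

/-- The squared distance of the division point from the Euclidean center of the first horoball. -/
theorem divisionPoint_dist (B B' : Horoball) :
    ‖(divisionPoint B B').1.1 - B.center‖ ^ 2 + ((divisionPoint B B').1.2 - B.radius) ^ 2
      = B.radius ^ 2 - (B.radius / (B.radius + B'.radius)) ^ 2 *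
        (4 * B.radius * B'.radius - ‖B.center - B'.center‖ ^ 2) := by
  have h := B.radius_pos
  have h' := B'.radius_pos
  have hne : B.radius + B'.radius ≠ 0 := (add_pos h h').ne'
  simp only [divisionPoint]
  rw [add_sub_cancel_left, norm_mul, Complex.norm_real, Real.norm_eq_abs, mul_pow, sq_abs,
    norm_sub_rev]
  field_simp
  ring

theorem interiorDisjoint_iff {B B' : Horoball} :
    B.InteriorDisjoint B' ↔ 4 * B.radius * B'.radius ≤ ‖B.center - B'.center‖ ^ 2 := by
  have hr := B.radius_pos
  have hr' := B'.radius_pos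
  constructor
  · intro h
    by_contra! hlt
    have key : ∀ {A A' : Horoball}, ‖A.center - A'.center‖ ^ 2 < 4 * A.radius * A'.radius →
        divisionPoint A A' ∈ interior A.carrier := by
      intro A A' hA
      apply mem_interior_of_lt
      rw [divisionPoint_dist]
      have h1 := A.radius_pos
      have h2 := A'.radius_pos
      have : 0 < (A.radius / (A.radius + A'.radius)) ^ 2 := by positivity
      nlinarith [mul_pos this (sub_pos.mpr hA)]
    refine Set.disjoint_left.mp h (key hlt) ?_
    rw [divisionPoint_comm]
    apply key
    rw [norm_sub_rev]
    linarith
  · intro h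
    refine Set.disjoint_left.mpr fun p hp hp' => ?_
    have h1 := lt_of_mem_interior hp
    -- a point in both interiors also lies in the smaller horoball inscribed in `B`
    have ht : 0 < p.1.2 := p.2
    have hx := sq_nonneg ‖p.1.1 - B.center‖
    have hq : (‖p.1.1 - B.center‖ ^ 2 + p.1.2 ^ 2) / (2 * p.1.2) < B.radius := by
      rw [div_lt_iff₀ (by positivity)]
      nlinarith
    have hq0 : 0 < (‖p.1.1 - B.center‖ ^ 2 + p.1.2 ^ 2) / (2 * p.1.2) := by positivity
    let A : Horoball := ⟨B.center, _, hq0⟩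
    have hA : p ∈ A.carrier := by
      show ‖p.1.1 - B.center‖ ^ 2 + (p.1.2 - A.radius) ^ 2 ≤ A.radius ^ 2
      have : A.radius * (2 * p.1.2) = ‖p.1.1 - B.center‖ ^ 2 + p.1.2 ^ 2 :=
        div_mul_cancel₀ _ (by positivity)
      nlinarith
    have h2 := normSq_sub_le_of_mem_carrier hA (interior_subset hp')
    have h3 : A.radius < B.radius := hq
    have h4 : A.center = B.center := rfl
    rw [h4] at h2
    nlinarith

theorem tangent_iff {B B' : Horoball} :
    B.Tangent B' ↔ ‖B.center - B'.center‖ ^ 2 = 4 * B.radius * B'.radius := by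
  unfold Tangent
  rw [interiorDisjoint_iff]
  constructor
  · rintro ⟨⟨p, hp, hp'⟩, h⟩
    exact le_antisymm (normSq_sub_le_of_mem_carrier hp hp') h
  · intro h
    refine ⟨⟨divisionPoint B B', ?_, ?_⟩, h.ge⟩
    · rw [mem_carrier, divisionPoint_dist, h]
      simp
    · rw [divisionPoint_comm]
      rw [mem_carrier, divisionPoint_dist, norm_sub_rev, h]
      apply le_of_eq
      ring

theorem interiorDisjoint_of_isFull {B B' : Horoball} (h : B.IsFull) (h' : B'.IsFull) :
    B.InteriorDisjoint B' ↔ 1 ≤ ‖B.center - B'.center‖ := by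
  rw [interiorDisjoint_iff, h, h', ← one_le_sq_iff₀ (norm_nonneg _)]
  norm_num

theorem tangent_of_isFull {B B' : Horoball} (h : B.IsFull) (h' : B'.IsFull) :
    B.Tangent B' ↔ ‖B.center - B'.center‖ = 1 := by
  rw [tangent_iff, h, h', ← pow_eq_one_iff_of_nonneg (norm_nonneg _) two_ne_zero]
  norm_num

end Horoball

/-! ### Angles subtended by a tie -/

/-- If the segment from `x` to `y` is not longer than the segments from `0` to `x` and `y`, it
subtends an angle of at most `π / 3` at `0`. -/
theorem abs_arg_div_le_pi_div_three {x y : ℂ} (hy : y ≠ 0) (hx : x ≠ 0)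
    (h1 : ‖x - y‖ ≤ ‖x‖) (h2 : ‖x - y‖ ≤ ‖y‖) : |Complex.arg (x / y)| ≤ Real.pi / 3 := by
  have hw0 : x / y ≠ 0 := div_ne_zero hx hy
  have hypos : 0 < ‖y‖ := norm_pos_iff.mpr hy
  have e : x / y - 1 = (x - y) / y := by field_simp
  have h1' : ‖x / y - 1‖ ≤ ‖x / y‖ := by
    rw [e, norm_div, norm_div]; gcongr
  have h2' : ‖x / y - 1‖ ≤ 1 := by
    rw [e, norm_div]; exact (div_le_one hypos).mpr h2
  generalize x / y = w at *
  have hwpos : 0 < ‖w‖ := norm_pos_iff.mpr hw0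
  have s0 : ‖w‖ ^ 2 = w.re ^ 2 + w.im ^ 2 := by
    rw [Complex.sq_norm, Complex.normSq_apply]; ring
  have s1 : ‖w - 1‖ ^ 2 = (w.re - 1) ^ 2 + w.im ^ 2 := by
    rw [Complex.sq_norm, Complex.normSq_apply]; simp; ring
  have q1 : ‖w - 1‖ ^ 2 ≤ ‖w‖ ^ 2 := pow_le_pow_left₀ (norm_nonneg _) h1' 2
  have q2 : ‖w - 1‖ ^ 2 ≤ 1 := by
    simpa using pow_le_pow_left₀ (norm_nonneg _) h2' 2
  have hcos : 1 / 2 ≤ Real.cos |Complex.arg w| := by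
    rw [Real.cos_abs, Complex.cos_arg hw0, le_div_iff₀ hwpos]
    rcases le_total ‖w‖ 1 with h | h <;> nlinarith
  by_contra! hlt
  have := Real.cos_lt_cos_of_nonneg_of_le_pi (by positivity) (Complex.abs_arg_le_pi w) hlt
  rw [Real.cos_pi_div_three] at this
  linarith

/-- The identity behind the bound `π / 2` for the sum of the angles that the segment from `y` to `x`
subtends at `0` and `c`: the sign of the left-hand side decides whether the sum is at most `π / 2` in
size, and for a segment that is not longer than the other distances between the four points all
summands on the right are non-negative. -/
theorem two_mul_re_mul_conj_eq (x y c : ℂ) :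
    2 * ((x * (x - c)) * (starRingEnd ℂ) (y * (y - c))).re =
      (‖x‖ ^ 2 - ‖x - y‖ ^ 2) * (‖x - c‖ ^ 2 - ‖x - y‖ ^ 2) +
      (‖y‖ ^ 2 - ‖x - y‖ ^ 2) * (‖y - c‖ ^ 2 - ‖x - y‖ ^ 2) +
      ‖x - y‖ ^ 2 * (‖c‖ ^ 2 - ‖x - y‖ ^ 2) := by
  simp only [Complex.sq_norm, Complex.normSq_apply, Complex.mul_re, Complex.mul_im,
    Complex.sub_re, Complex.sub_im, Complex.conj_re, Complex.conj_im]
  ring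

theorem re_div_nonneg_iff {z w : ℂ} (hw : w ≠ 0) :
    0 ≤ (z / w).re ↔ 0 ≤ (z * (starRingEnd ℂ) w).re := by
  have : (z / w).re = (z * (starRingEnd ℂ) w).re / Complex.normSq w := by
    rw [Complex.div_re]; simp; ring
  rw [this, le_div_iff₀ (Complex.normSq_pos.mpr hw), zero_mul]

theorem re_div_eq_zero_iff {z w : ℂ} (hw : w ≠ 0) :
    (z / w).re = 0 ↔ (z * (starRingEnd ℂ) w).re = 0 := by
  have : (z / w).re = (z * (starRingEnd ℂ) w).re / Complex.normSq w := by
    rw [Complex.div_re]; simp; ring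
  rw [this, div_eq_zero_iff, or_iff_left (Complex.normSq_pos.mpr hw).ne']

/-- The hypotheses on a segment from `y` to `x` relative to two points `0` and `c` (translates of
the centers of `C₁` and `C₂`): the segment is non-degenerate and not longer than any other segment
between the four points. -/
structure IsShortSegment (x y c : ℂ) : Prop where
  ne : x ≠ y
  left_end : ‖x - y‖ ≤ ‖x‖
  left_start : ‖x - y‖ ≤ ‖y‖
  right_end : ‖x - y‖ ≤ ‖x - c‖
  right_start : ‖x - y‖ ≤ ‖y - c‖
  axis : ‖x - y‖ ≤ ‖c‖

namespace IsShortSegment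

variable {x y c : ℂ}

theorem norm_pos (h : IsShortSegment x y c) : 0 < ‖x - y‖ := norm_pos_iff.mpr (sub_ne_zero.mpr h.ne)

theorem end_ne_zero (h : IsShortSegment x y c) : x ≠ 0 :=
  norm_pos_iff.mp (h.norm_pos.trans_le h.left_end)

theorem start_ne_zero (h : IsShortSegment x y c) : y ≠ 0 :=
  norm_pos_iff.mp (h.norm_pos.trans_le h.left_start)

theorem end_sub_ne_zero (h : IsShortSegment x y c) : x - c ≠ 0 :=
  norm_pos_iff.mp (h.norm_pos.trans_le h.right_end)

theorem start_sub_ne_zero (h : IsShortSegment x y c) : y - c ≠ 0 :=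
  norm_pos_iff.mp (h.norm_pos.trans_le h.right_start)

theorem abs_arg_left (h : IsShortSegment x y c) : |Complex.arg (x / y)| ≤ Real.pi / 3 :=
  abs_arg_div_le_pi_div_three h.start_ne_zero h.end_ne_zero h.left_end h.left_start

theorem abs_arg_right (h : IsShortSegment x y c) :
    |Complex.arg ((x - c) / (y - c))| ≤ Real.pi / 3 :=
  abs_arg_div_le_pi_div_three h.start_sub_ne_zero h.end_sub_ne_zero
    (by rw [sub_sub_sub_cancel_right]; exact h.right_end)
    (by rw [sub_sub_sub_cancel_right]; exact h.right_start)

theorem arg_add_arg (h : IsShortSegment x y c) :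
    Complex.arg (x / y) + Complex.arg ((x - c) / (y - c)) =
      Complex.arg ((x * (x - c)) / (y * (y - c))) := by
  have h1 := abs_le.mp h.abs_arg_left
  have h2 := abs_le.mp h.abs_arg_right
  have := Real.pi_pos
  rw [← div_mul_div_comm]
  refine (Complex.arg_mul (div_ne_zero h.end_ne_zero h.start_ne_zero)
    (div_ne_zero h.end_sub_ne_zero h.start_sub_ne_zero) ⟨?_, ?_⟩).symm <;> linarith

/-- The signed angles that a short segment subtends at the two points add up to at most a right
angle. -/
theorem abs_arg_add_arg_le (h : IsShortSegment x y c) :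
    |Complex.arg (x / y) + Complex.arg ((x - c) / (y - c))| ≤ Real.pi / 2 := by
  rw [h.arg_add_arg, Complex.abs_arg_le_pi_div_two_iff,
    re_div_nonneg_iff (mul_ne_zero h.start_ne_zero h.start_sub_ne_zero)]
  have key := two_mul_re_mul_conj_eq x y c
  have sq : ∀ {a : ℝ}, ‖x - y‖ ≤ a → 0 ≤ a ^ 2 - ‖x - y‖ ^ 2 := fun ha =>
    sub_nonneg.mpr (pow_le_pow_left₀ (norm_nonneg _) ha 2)
  have h1 := mul_nonneg (sq h.left_end) (sq h.right_end)
  have h2 := mul_nonneg (sq h.left_start) (sq h.right_start)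
  have h3 := mul_nonneg (sq_nonneg ‖x - y‖) (sq h.axis)
  linarith

/-- If the angles subtended at the two points add up to a right angle, the two points are at the
same distance from each other as the ends of the segment, and each end of the segment has this
distance from one of the two points. -/
theorem of_abs_arg_add_arg_eq (h : IsShortSegment x y c)
    (heq : |Complex.arg (x / y) + Complex.arg ((x - c) / (y - c))| = Real.pi / 2) :
    ‖c‖ = ‖x - y‖ ∧ (‖y‖ = ‖x - y‖ ∨ ‖y - c‖ = ‖x - y‖) := by
  rw [h.arg_add_arg] at heq
  replace heq : ((x * (x - c)) / (y * (y - c))).re = 0 :=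
    (eq_or_eq_neg_of_abs_eq heq).elim (fun h => (Complex.arg_eq_pi_div_two_iff.mp h).1)
      (fun h => (Complex.arg_eq_neg_pi_div_two_iff.mp h).1)
  rw [re_div_eq_zero_iff (mul_ne_zero h.start_ne_zero h.start_sub_ne_zero)] at heq
  have key := two_mul_re_mul_conj_eq x y c
  have sq : ∀ {a : ℝ}, ‖x - y‖ ≤ a → 0 ≤ a ^ 2 - ‖x - y‖ ^ 2 := fun ha =>
    sub_nonneg.mpr (pow_le_pow_left₀ (norm_nonneg _) ha 2)
  have h1 := mul_nonneg (sq h.left_end) (sq h.right_end)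
  have h2 := mul_nonneg (sq h.left_start) (sq h.right_start)
  have h3 := mul_nonneg (sq_nonneg ‖x - y‖) (sq h.axis)
  have e2 : (‖y‖ ^ 2 - ‖x - y‖ ^ 2) * (‖y - c‖ ^ 2 - ‖x - y‖ ^ 2) = 0 := by linarith
  have e3 : ‖x - y‖ ^ 2 * (‖c‖ ^ 2 - ‖x - y‖ ^ 2) = 0 := by linarith
  have root : ∀ {z : ℂ}, ‖z‖ ^ 2 - ‖x - y‖ ^ 2 = 0 → ‖z‖ = ‖x - y‖ := fun hz =>
    (pow_left_inj₀ (norm_nonneg _) (norm_nonneg _) two_ne_zero).mp (sub_eq_zero.mp hz)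
  exact ⟨root ((mul_eq_zero.mp e3).resolve_left (pow_pos h.norm_pos 2).ne'),
    (mul_eq_zero.mp e2).imp root root⟩

end IsShortSegment

theorem arg_le_arg_sub_one {z : ℂ} (h0 : z ≠ 0) (h1 : z - 1 ≠ 0) (him : 0 ≤ z.im) :
    Complex.arg z ≤ Complex.arg (z - 1) := by
  have him' : 0 ≤ (z - 1).im := by simpa using him
  rw [Complex.arg_of_im_nonneg_of_ne_zero him h0, Complex.arg_of_im_nonneg_of_ne_zero him' h1]
  apply Real.arccos_le_arccos
  rw [div_le_div_iff₀ (norm_pos_iff.mpr h1) (norm_pos_iff.mpr h0)]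
  have s0 : ‖z‖ ^ 2 = z.re ^ 2 + z.im ^ 2 := by
    rw [Complex.sq_norm, Complex.normSq_apply]; ring
  have s1 : ‖z - 1‖ ^ 2 = (z.re - 1) ^ 2 + z.im ^ 2 := by
    rw [Complex.sq_norm, Complex.normSq_apply]; simp; ring
  have p0 := norm_nonneg z
  have p1 := norm_nonneg (z - 1)
  have hre : (z - 1).re = z.re - 1 := by simp
  rw [hre]
  have hy := sq_nonneg z.im
  rcases le_total 0 z.re with hz | hz
  · rcases le_total 0 (z.re - 1) with hz' | hz'
    · refine le_of_sq_le_sq ?_ (by positivity)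
      rw [mul_pow, mul_pow, s0, s1]
      nlinarith [mul_nonneg hy hz, mul_nonneg hy hz']
    · exact (mul_nonpos_of_nonpos_of_nonneg hz' p0).trans (by positivity)
  · rw [← neg_le_neg_iff, ← neg_mul, ← neg_mul]
    refine le_of_sq_le_sq ?_ (mul_nonneg (by linarith) p0)
    rw [mul_pow, mul_pow, s0, s1]
    nlinarith [mul_nonneg hy (neg_nonneg.mpr hz)]

theorem arg_sub_one_le_arg {z : ℂ} (him : z.im < 0) :
    Complex.arg (z - 1) ≤ Complex.arg z := by
  have key : ∀ w : ℂ, w.im < 0 → Complex.arg ((starRingEnd ℂ) w) = -Complex.arg w := by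
    intro w hw
    rw [Complex.arg_conj, if_neg]
    intro h
    exact hw.ne (Complex.arg_eq_pi_iff.mp h).2
  have him' : (z - 1).im < 0 := by simpa using him
  have h0 : (starRingEnd ℂ) z ≠ 0 := fun h => him.ne (by simpa using congrArg Complex.im h)
  have h1 : (starRingEnd ℂ) z - 1 ≠ 0 := fun h => him.ne (by simpa using congrArg Complex.im h)
  have := arg_le_arg_sub_one h0 h1 (by simpa using him.le)
  rw [key z him, show (starRingEnd ℂ) z - 1 = (starRingEnd ℂ) (z - 1) by simp, key _ him'] at this
  linarith

/-! ### Angle sums of closed polygons -/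

theorem arg_div_eq_sub_add {z w : ℂ} (hz : z ≠ 0) (hw : w ≠ 0) :
    ∃ n : ℤ, Complex.arg (z / w) = Complex.arg z - Complex.arg w + 2 * Real.pi * n := by
  have h := Complex.arg_div_coe_angle hz hw
  rw [← Real.Angle.coe_sub, Real.Angle.angle_eq_iff_two_pi_dvd_sub] at h
  obtain ⟨n, hn⟩ := h
  exact ⟨n, by linarith⟩

theorem sum_zmod_sub_succ {k : ℕ} [NeZero k] (f : ZMod k → ℝ) : ∑ j, (f (j + 1) - f j) = 0 := by
  rw [Finset.sum_sub_distrib, sub_eq_zero]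
  exact Equiv.sum_comp (Equiv.addRight (1 : ZMod k)) f

theorem sum_zmod_eq_sum_range {k : ℕ} [NeZero k] (f : ZMod k → ℝ) (a : ZMod k) :
    ∑ j, f j = ∑ i ∈ Finset.range k, f (a + i) := by
  rw [← Equiv.sum_comp (Equiv.addLeft a) f]
  refine Finset.sum_bij' (fun j _ => j.val) (fun i _ => (i : ZMod k)) ?_ ?_ ?_ ?_ ?_
  · intro j _; exact Finset.mem_range.mpr j.val_lt
  · intro i _; exact Finset.mem_univ _
  · intro j _; exact ZMod.natCast_zmod_val j
  · intro i hi; exact ZMod.val_cast_of_lt (Finset.mem_range.mp hi)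
  · intro j _; simp

/-- The angle sum of a closed polygon about a point that is not a vertex is a multiple of `2π`. -/
theorem exists_sum_arg_div_eq {k : ℕ} [NeZero k] {p : ZMod k → ℂ} (hp : ∀ j, p j ≠ 0) :
    ∃ n : ℤ, ∑ j, Complex.arg (p (j + 1) / p j) = 2 * Real.pi * n := by
  choose n hn using fun j => arg_div_eq_sub_add (hp (j + 1)) (hp j)
  refine ⟨∑ j, n j, ?_⟩
  rw [Finset.sum_congr rfl fun j _ => hn j, Finset.sum_add_distrib,
    sum_zmod_sub_succ fun j => Complex.arg (p j), ← Finset.mul_sum]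
  push_cast
  ring

/-- A sum of at most eight angles of size at most `π / 3` that is a non-zero multiple of `2π` is
`2π` or `-2π`. -/
theorem sum_arg_eq_or_eq {k : ℕ} [NeZero k] (hk : k ≤ 8) {p : ZMod k → ℂ} (hp : ∀ j, p j ≠ 0)
    (hα : ∀ j, |Complex.arg (p (j + 1) / p j)| ≤ Real.pi / 3)
    (hne : ∑ j, Complex.arg (p (j + 1) / p j) ≠ 0) :
    ∑ j, Complex.arg (p (j + 1) / p j) = 2 * Real.pi ∨
      ∑ j, Complex.arg (p (j + 1) / p j) = -(2 * Real.pi) := by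
  obtain ⟨n, hn⟩ := exists_sum_arg_div_eq hp
  have hle : |∑ j, Complex.arg (p (j + 1) / p j)| ≤ k * (Real.pi / 3) := by
    refine (Finset.abs_sum_le_sum_abs _ _).trans ((Finset.sum_le_sum fun j _ => hα j).trans ?_)
    simp
  have hπ := Real.pi_pos
  have hk' : (k : ℝ) ≤ 8 := by exact_mod_cast hk
  have hlt : |2 * Real.pi * n| < 2 * Real.pi * 2 := by
    rw [← hn]
    nlinarith
  rw [abs_mul, abs_of_pos (by positivity)] at hlt
  have hn2 : |n| < 2 := by exact_mod_cast lt_of_mul_lt_mul_left hlt (by positivity)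
  have hn0 : n ≠ 0 := by
    rintro rfl
    exact hne (by simpa using hn)
  rw [abs_lt] at hn2
  have : n = 1 ∨ n = -1 := by omega
  rcases this with rfl | rfl
  · left; simpa using hn
  · right; simpa using hn

/-! ### Opposite winding numbers -/

theorem two_pi_mul_int_lt {n a : ℤ} (h : 2 * Real.pi * n < 2 * Real.pi * a) : n < a := by
  have := Real.pi_pos
  exact_mod_cast lt_of_mul_lt_mul_left h (by positivity)

theorem two_pi_mul_int_eq_zero {n : ℤ} (h1 : -(2 * Real.pi) < 2 * Real.pi * n)
    (h2 : 2 * Real.pi * n < 2 * Real.pi) : 2 * Real.pi * (n : ℝ) = 0 := by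
  have h3 : n < 1 := two_pi_mul_int_lt (by simpa using h2)
  have h4 : -1 < n := two_pi_mul_int_lt (by simpa using h1)
  have : n = 0 := by omega
  simp [this]

theorem two_pi_mul_int_eq_two_pi {n : ℤ} (h1 : 0 < 2 * Real.pi * n)
    (h2 : 2 * Real.pi * n < 4 * Real.pi) : 2 * Real.pi * (n : ℝ) = 2 * Real.pi := by
  have := two_pi_mul_int_eq_zero (n := n - 1) (by push_cast; linarith) (by push_cast; linarith)
  push_cast at this
  linarith

/-- A run of `s` of at most eight angles of size at most `π / 3` with sum `2π` turns by at least
`(s - 2) π / 3`. -/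
theorem sum_range_bounds {f : ℕ → ℝ} {k s : ℕ} (hk : k ≤ 8) (hs : s ≤ k)
    (hf : ∀ i, |f i| ≤ Real.pi / 3) (hsum : ∑ i ∈ Finset.range k, f i = 2 * Real.pi) :
    (s - 2) * (Real.pi / 3) ≤ ∑ i ∈ Finset.range s, f i ∧
      ∑ i ∈ Finset.range s, f i ≤ s * (Real.pi / 3) := by
  have hup : ∀ t : Finset ℕ, ∑ i ∈ t, f i ≤ t.card * (Real.pi / 3) := fun t => by
    refine (Finset.sum_le_sum fun i _ => (abs_le.mp (hf i)).2).trans ?_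
    simp
  constructor
  · have h1 := Finset.sum_range_add_sum_Ico f hs
    have h2 := hup (Finset.Ico s k)
    rw [Nat.card_Ico, Nat.cast_sub hs] at h2
    have hk' : (k : ℝ) ≤ 8 := by exact_mod_cast hk
    have := Real.pi_pos
    nlinarith
  · simpa using hup (Finset.range s)

theorem arg_add_natCast_eq {k : ℕ} {p : ZMod k → ℂ} (hp : ∀ j, p j ≠ 0) (a : ZMod k) (s : ℕ) :
    ∃ n : ℤ, Complex.arg (p a) +
      ∑ i ∈ Finset.range s, Complex.arg (p (a + i + 1) / p (a + i)) =
        Complex.arg (p (a + s)) + 2 * Real.pi * n := by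
  induction s with
  | zero => exact ⟨0, by simp⟩
  | succ s ih =>
    obtain ⟨n, hn⟩ := ih
    obtain ⟨m, hm⟩ := arg_div_eq_sub_add (hp (a + s + 1)) (hp (a + s))
    refine ⟨n + m, ?_⟩
    rw [Finset.sum_range_succ, ← add_assoc, hn, hm]
    push_cast
    rw [add_assoc a]
    ring

/-- If the angle sums about `0` and `1` are `2π` and `-2π`, some edge crosses the segment from `0`
to `1` upwards.  Only the consequences for the arguments of its final point are recorded. -/
theorem exists_upward_crossing {k : ℕ} [NeZero k] {p : ZMod k → ℂ}
    (h0 : ∀ j, p j ≠ 0) (h1 : ∀ j, p j - 1 ≠ 0)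
    (hα : ∀ j, |Complex.arg (p (j + 1) / p j)| ≤ Real.pi / 3)
    (hβ : ∀ j, |Complex.arg ((p (j + 1) - 1) / (p j - 1))| ≤ Real.pi / 3)
    (hA : ∑ j, Complex.arg (p (j + 1) / p j) = 2 * Real.pi)
    (hB : ∑ j, Complex.arg ((p (j + 1) - 1) / (p j - 1)) = -(2 * Real.pi)) :
    ∃ a, 0 ≤ Complex.arg (p a) ∧ Complex.arg (p a) < Real.pi / 3 ∧
      2 * Real.pi / 3 < Complex.arg (p a - 1) := by
  have hπ := Real.pi_pos
  choose x hx using fun j => arg_div_eq_sub_add (h0 (j + 1)) (h0 j)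
  choose y hy using fun j => arg_div_eq_sub_add (h1 (j + 1)) (h1 j)
  have hxs : 2 * Real.pi * ∑ j, (x j : ℝ) = 2 * Real.pi := by
    rwa [Finset.sum_congr rfl fun j _ => hx j, Finset.sum_add_distrib,
      sum_zmod_sub_succ fun j => Complex.arg (p j), ← Finset.mul_sum, zero_add] at hA
  have hys : 2 * Real.pi * ∑ j, (y j : ℝ) = -(2 * Real.pi) := by
    rwa [Finset.sum_congr rfl fun j _ => hy j, Finset.sum_add_distrib,
      sum_zmod_sub_succ fun j => Complex.arg (p j - 1), ← Finset.mul_sum, zero_add] at hB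
  have hex : ∃ j, 1 ≤ x j - y j := by
    by_contra! hcon
    have h2 : ∑ j, ((x j : ℝ) - y j) ≤ 0 := by
      refine Finset.sum_nonpos fun j _ => ?_
      have : x j - y j ≤ 0 := by have := hcon j; omega
      exact_mod_cast this
    rw [Finset.sum_sub_distrib] at h2
    nlinarith
  obtain ⟨j, hj⟩ := hex
  have hα' := abs_le.mp (hα j)
  have hβ' := abs_le.mp (hβ j)
  rw [hx j] at hα'
  rw [hy j] at hβ'
  have him : ∀ i, (p i - 1).im = (p i).im := fun i => by simp
  have u1 := Complex.arg_le_pi (p j)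
  have u2 := Complex.neg_pi_lt_arg (p j)
  have u3 := Complex.arg_le_pi (p (j + 1))
  have u4 := Complex.neg_pi_lt_arg (p (j + 1))
  have v1 := Complex.arg_le_pi (p j - 1)
  have v2 := Complex.neg_pi_lt_arg (p j - 1)
  have v3 := Complex.arg_le_pi (p (j + 1) - 1)
  have v4 := Complex.neg_pi_lt_arg (p (j + 1) - 1)
  rcases le_or_gt 0 (p j).im with hs | hs <;> rcases le_or_gt 0 (p (j + 1)).im with ht | ht
  · -- both ends in the closed upper half-plane
    have := Complex.arg_nonneg_iff.mpr hs
    have := Complex.arg_nonneg_iff.mpr ht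
    have := Complex.arg_nonneg_iff.mpr ((him j).symm ▸ hs)
    have := Complex.arg_nonneg_iff.mpr ((him (j + 1)).symm ▸ ht)
    have a1 : x j < 1 := two_pi_mul_int_lt (by push_cast; linarith)
    have a2 : -1 < y j := two_pi_mul_int_lt (by push_cast; linarith)
    omega
  · -- a downward crossing of the segment in this direction of turning would need
    -- `arg (p j - 1) < arg (p j)`, which is false in the upper half-plane
    have := Complex.arg_nonneg_iff.mpr hs
    have := Complex.arg_neg_iff.mpr ht
    have := Complex.arg_nonneg_iff.mpr ((him j).symm ▸ hs)
    have := Complex.arg_neg_iff.mpr ((him (j + 1)).symm ▸ ht)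
    have hle := arg_le_arg_sub_one (h0 j) (h1 j) hs
    have a1 : x j < 2 := two_pi_mul_int_lt (by push_cast; linarith)
    have a2 : -1 < y j := two_pi_mul_int_lt (by push_cast; linarith)
    have b1 : x j = 1 := by omega
    have b2 : y j = 0 := by omega
    rw [b1] at hα'
    rw [b2] at hβ'
    push_cast at hα' hβ'
    linarith
  · have := Complex.arg_neg_iff.mpr hs
    have hu := Complex.arg_nonneg_iff.mpr ht
    have := Complex.arg_neg_iff.mpr ((him j).symm ▸ hs)
    have := Complex.arg_nonneg_iff.mpr ((him (j + 1)).symm ▸ ht)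
    have a1 : x j < 1 := two_pi_mul_int_lt (by push_cast; linarith)
    have a2 : -2 < y j := two_pi_mul_int_lt (by push_cast; linarith)
    have b1 : x j = 0 := by omega
    have b2 : y j = -1 := by omega
    rw [b1] at hα'
    rw [b2] at hβ'
    push_cast at hα' hβ'
    exact ⟨j + 1, hu, by linarith, by linarith⟩
  · have := Complex.arg_neg_iff.mpr hs
    have := Complex.arg_neg_iff.mpr ht
    have := Complex.arg_neg_iff.mpr ((him j).symm ▸ hs)
    have := Complex.arg_neg_iff.mpr ((him (j + 1)).symm ▸ ht)
    have a1 : x j < 1 := two_pi_mul_int_lt (by push_cast; linarith)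
    have a2 : -1 < y j := two_pi_mul_int_lt (by push_cast; linarith)
    omega

/-- A closed polygon with at most eight edges, each subtending an angle of at most `π / 3` at `0`
and at `1`, does not wind once around `0` and once in the opposite direction around `1`.

The continuous arguments `U` about `0` and `V` about `1` are followed from the end of an edge that
crosses the segment from `0` to `1` upwards.  The number of edges leaves so little slack that three
edges later the polygon is still in the upper half-plane, where `U ≤ V`, and one edge after that
`V < U`, although a single edge does not suffice to come round through the segment again. -/
theorem not_opposite_winding {k : ℕ} [NeZero k] (hk : k ≤ 8) {p : ZMod k → ℂ}
    (h0 : ∀ j, p j ≠ 0) (h1 : ∀ j, p j - 1 ≠ 0)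
    (hα : ∀ j, |Complex.arg (p (j + 1) / p j)| ≤ Real.pi / 3)
    (hβ : ∀ j, |Complex.arg ((p (j + 1) - 1) / (p j - 1))| ≤ Real.pi / 3)
    (hA : ∑ j, Complex.arg (p (j + 1) / p j) = 2 * Real.pi)
    (hB : ∑ j, Complex.arg ((p (j + 1) - 1) / (p j - 1)) = -(2 * Real.pi)) : False := by
  have hπ := Real.pi_pos
  obtain ⟨a, hu0, hu1, hv0⟩ := exists_upward_crossing h0 h1 hα hβ hA hB
  have hv1 := Complex.arg_le_pi (p a - 1)
  rw [sum_zmod_eq_sum_range _ a] at hA hB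
  have hk4 : 4 ≤ k := by
    have h2 := Finset.sum_le_sum (s := Finset.range k) fun i _ => (abs_le.mp (hα (a + i))).2
    rw [hA] at h2
    simp only [Finset.sum_const, Finset.card_range, nsmul_eq_mul] at h2
    have h3 : (6 : ℝ) ≤ k := by
      by_contra! hlt
      nlinarith
    have h4 : 6 ≤ k := by exact_mod_cast h3
    omega
  have hB' : ∑ i ∈ Finset.range k,
      -Complex.arg ((p (a + i + 1) - 1) / (p (a + i) - 1)) = 2 * Real.pi := by
    rw [Finset.sum_neg_distrib, hB, neg_neg]
  have bA := fun s hs => sum_range_bounds (s := s) hk hs (fun i => hα (a + i)) hA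
  have bB := fun s hs => sum_range_bounds (s := s) hk hs
    (fun i => (abs_neg _).trans_le (hβ (a + i))) hB'
  have A3 := bA 3 (by omega)
  have A4 := bA 4 hk4
  have B3 := bB 3 (by omega)
  have B4 := bB 4 hk4
  rw [Finset.sum_neg_distrib] at B3 B4
  obtain ⟨i3, hi3⟩ := arg_add_natCast_eq h0 a 3
  obtain ⟨i4, hi4⟩ := arg_add_natCast_eq h0 a 4
  obtain ⟨j3, hj3⟩ := arg_add_natCast_eq h1 a 3
  obtain ⟨j4, hj4⟩ := arg_add_natCast_eq h1 a 4
  have sA := Finset.sum_range_succ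
    (fun i : ℕ => Complex.arg (p (a + i + 1) / p (a + i))) 3
  have sB := Finset.sum_range_succ
    (fun i : ℕ => Complex.arg ((p (a + i + 1) - 1) / (p (a + i) - 1))) 3
  have e1 := abs_le.mp (hα (a + (3 : ℕ)))
  have e2 := abs_le.mp (hβ (a + (3 : ℕ)))
  norm_num only [Nat.reduceAdd] at sA sB
  generalize ∑ i ∈ Finset.range 3, Complex.arg (p (a + i + 1) / p (a + i)) = SA3 at *
  generalize ∑ i ∈ Finset.range 4, Complex.arg (p (a + i + 1) / p (a + i)) = SA4 at *
  generalize ∑ i ∈ Finset.range 3, Complex.arg ((p (a + i + 1) - 1) / (p (a + i) - 1)) = SB3 at *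
  generalize ∑ i ∈ Finset.range 4, Complex.arg ((p (a + i + 1) - 1) / (p (a + i) - 1)) = SB4 at *
  norm_num only [Nat.cast_ofNat] at A3 A4 B3 B4
  have u1 : ∀ z, Complex.arg z ≤ Real.pi := Complex.arg_le_pi
  have u2 : ∀ z, -Real.pi < Complex.arg z := Complex.neg_pi_lt_arg
  have him : ∀ i, (p i - 1).im = (p i).im := fun i => by simp
  -- `U ≤ V` after three edges: the bounds on `U` and `V` determine their branches, and they exclude
  -- the lower half-plane, where the principal arguments are in the opposite order
  have hUV : Complex.arg (p a) + SA3 ≤ Complex.arg (p a - 1) + SB3 := by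
    have u3 := u1 (p (a + (3 : ℕ)))
    have u4 := u2 (p (a + (3 : ℕ)))
    have u5 := u1 (p (a + (3 : ℕ)) - 1)
    have u6 := u2 (p (a + (3 : ℕ)) - 1)
    rcases le_or_gt 0 (p (a + (3 : ℕ))).im with hs | hs
    · have := Complex.arg_nonneg_iff.mpr hs
      have := Complex.arg_nonneg_iff.mpr ((him _).symm ▸ hs)
      have := arg_le_arg_sub_one (h0 _) (h1 _) hs
      have := two_pi_mul_int_eq_zero (n := i3) (by linarith) (by linarith)
      have := two_pi_mul_int_eq_zero (n := j3) (by linarith) (by linarith)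
      linarith
    · have := Complex.arg_neg_iff.mpr hs
      have := Complex.arg_neg_iff.mpr ((him _).symm ▸ hs)
      have := arg_sub_one_le_arg hs
      have := two_pi_mul_int_eq_two_pi (n := i3) (by linarith) (by linarith)
      have := two_pi_mul_int_eq_zero (n := j3) (by linarith) (by linarith)
      linarith
  -- After four edges `U - V` is at least `π / 3`, which excludes the upper half-plane, and by `hUV` at
  -- most `2π / 3`, whereas in the lower half-plane `U - 2π` and `V` would be principal arguments.
  have u3 := u1 (p (a + (4 : ℕ)))
  have u4 := u2 (p (a + (4 : ℕ)))
  have u5 := u1 (p (a + (4 : ℕ)) - 1)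
  have u6 := u2 (p (a + (4 : ℕ)) - 1)
  rcases le_or_gt 0 (p (a + (4 : ℕ))).im with hs | hs
  · have := Complex.arg_nonneg_iff.mpr hs
    have := Complex.arg_nonneg_iff.mpr ((him _).symm ▸ hs)
    have := arg_le_arg_sub_one (h0 _) (h1 _) hs
    have := two_pi_mul_int_eq_zero (n := i4) (by linarith) (by linarith)
    have := two_pi_mul_int_eq_zero (n := j4) (by linarith) (by linarith)
    linarith
  · have := Complex.arg_neg_iff.mpr hs
    have := Complex.arg_neg_iff.mpr ((him _).symm ▸ hs)
    have := arg_sub_one_le_arg hs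
    have := two_pi_mul_int_eq_two_pi (n := i4) (by linarith) (by linarith)
    have := two_pi_mul_int_eq_zero (n := j4) (by linarith) (by linarith)
    linarith

/-! ### The bound for the number of edges and its equality case -/

section Polygon

variable {k : ℕ} [NeZero k] {p : ZMod k → ℂ} {c : ℂ}

/-- A closed polygon of at most eight short segments that winds around both `0` and `c` winds
around both of them once, in the same direction. -/
theorem sum_arg_eq_and_eq (hk : k ≤ 8) (hp : ∀ j, IsShortSegment (p (j + 1)) (p j) c)
    (hA : ∑ j, Complex.arg (p (j + 1) / p j) ≠ 0)
    (hB : ∑ j, Complex.arg ((p (j + 1) - c) / (p j - c)) ≠ 0) :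
    (∑ j, Complex.arg (p (j + 1) / p j) = 2 * Real.pi ∧
      ∑ j, Complex.arg ((p (j + 1) - c) / (p j - c)) = 2 * Real.pi) ∨
    (∑ j, Complex.arg (p (j + 1) / p j) = -(2 * Real.pi) ∧
      ∑ j, Complex.arg ((p (j + 1) - c) / (p j - c)) = -(2 * Real.pi)) := by
  have hc : c ≠ 0 := norm_pos_iff.mp ((hp 0).norm_pos.trans_le (hp 0).axis)
  have h0 : ∀ j, p j ≠ 0 := fun j => (hp j).start_ne_zero
  have h1 : ∀ j, p j - c ≠ 0 := fun j => (hp j).start_sub_ne_zero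
  have hα := fun j => (hp j).abs_arg_left
  have hβ := fun j => (hp j).abs_arg_right
  -- the polygon in the coordinate in which `c` is `1`, and its image under `z ↦ 1 - z`
  have q0 : ∀ j, p j / c ≠ 0 := fun j => div_ne_zero (h0 j) hc
  have q1 : ∀ j, p j / c - 1 = (p j - c) / c := fun j => by field_simp
  have r0 : ∀ j, p (j + 1) / c / (p j / c) = p (j + 1) / p j := fun j =>
    div_div_div_cancel_right₀ hc _ _
  have r1 : ∀ j, (p (j + 1) / c - 1) / (p j / c - 1) = (p (j + 1) - c) / (p j - c) := fun j => by
    rw [q1, q1, div_div_div_cancel_right₀ hc]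
  have r2 : ∀ j, (1 - p (j + 1) / c) / (1 - p j / c) = (p (j + 1) - c) / (p j - c) := fun j => by
    rw [← neg_sub (p (j + 1) / c), ← neg_sub (p j / c), neg_div_neg_eq, r1]
  have r3 : ∀ j, (1 - p (j + 1) / c - 1) / (1 - p j / c - 1) = p (j + 1) / p j := fun j => by
    rw [sub_sub_cancel_left, sub_sub_cancel_left, neg_div_neg_eq, r0]
  rcases sum_arg_eq_or_eq hk h0 hα hA with hA | hA <;>
    rcases sum_arg_eq_or_eq (p := fun j => p j - c) hk h1 hβ hB with hB | hB
  · exact Or.inl ⟨hA, hB⟩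
  · refine (not_opposite_winding (p := fun j => p j / c) hk q0
      (fun j => by simp only [q1]; exact div_ne_zero (h1 j) hc) ?_ ?_ ?_ ?_).elim
    all_goals simpa only [r0, r1]
  · refine (not_opposite_winding (p := fun j => 1 - p j / c) hk
      (fun j => ?_) (fun j => ?_) ?_ ?_ ?_ ?_).elim
    · rw [← neg_sub, neg_ne_zero, q1]; exact div_ne_zero (h1 j) hc
    · rw [sub_sub_cancel_left, neg_ne_zero]; exact q0 j
    all_goals simpa only [r2, r3]
  · exact Or.inr ⟨hA, hB⟩

/-- A closed polygon of short segments that winds around both `0` and `c` has at least eight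
edges. -/
theorem eight_le_of_winding (hp : ∀ j, IsShortSegment (p (j + 1)) (p j) c)
    (hA : ∑ j, Complex.arg (p (j + 1) / p j) ≠ 0)
    (hB : ∑ j, Complex.arg ((p (j + 1) - c) / (p j - c)) ≠ 0) : 8 ≤ k := by
  by_contra! hk
  have h4 : |∑ j, (Complex.arg (p (j + 1) / p j) + Complex.arg ((p (j + 1) - c) / (p j - c)))| =
      4 * Real.pi := by
    have := Real.pi_pos
    rw [Finset.sum_add_distrib]
    rcases sum_arg_eq_and_eq hk.le hp hA hB with ⟨a, b⟩ | ⟨a, b⟩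
    · rw [a, b, abs_of_pos (by positivity)]; ring
    · rw [a, b, abs_of_neg (by linarith)]; ring
  have hle := (Finset.abs_sum_le_sum_abs _ _).trans
    (Finset.sum_le_sum fun j (_ : j ∈ Finset.univ) => (hp j).abs_arg_add_arg_le)
  rw [h4] at hle
  simp only [Finset.sum_const, Finset.card_univ, ZMod.card, nsmul_eq_mul] at hle
  have hk' : (k : ℝ) < 8 := by exact_mod_cast hk
  nlinarith [Real.pi_pos]

end Polygon

/-- In a polygon with eight edges there is no slack: every edge turns by exactly a right angle in
total, always in the same direction. -/
theorem arg_add_arg_eq_of_eight {p : ZMod 8 → ℂ} {c : ℂ}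
    (hp : ∀ j, IsShortSegment (p (j + 1)) (p j) c)
    (hA : ∑ j, Complex.arg (p (j + 1) / p j) ≠ 0)
    (hB : ∑ j, Complex.arg ((p (j + 1) - c) / (p j - c)) ≠ 0) :
    (∀ j, Complex.arg (p (j + 1) / p j) + Complex.arg ((p (j + 1) - c) / (p j - c)) =
      Real.pi / 2) ∨
    (∀ j, Complex.arg (p (j + 1) / p j) + Complex.arg ((p (j + 1) - c) / (p j - c)) =
      -(Real.pi / 2)) := by
  have key : ∀ g : ZMod 8 → ℝ, (∀ j, g j ≤ Real.pi / 2) → ∑ j, g j = 4 * Real.pi →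
      ∀ j, g j = Real.pi / 2 := by
    intro g hg hs j
    have h0 : ∑ j, (Real.pi / 2 - g j) = 0 := by
      rw [Finset.sum_sub_distrib, hs]
      simp only [Finset.sum_const, Finset.card_univ, ZMod.card, nsmul_eq_mul]
      push_cast
      ring
    have := (Finset.sum_eq_zero_iff_of_nonneg fun j _ => sub_nonneg.mpr (hg j)).mp h0 j
      (Finset.mem_univ j)
    linarith
  rcases sum_arg_eq_and_eq le_rfl hp hA hB with ⟨a, b⟩ | ⟨a, b⟩
  · left
    refine key _ (fun j => (abs_le.mp (hp j).abs_arg_add_arg_le).2) ?_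
    rw [Finset.sum_add_distrib, a, b]
    ring
  · right
    intro j
    rw [← neg_eq_iff_eq_neg]
    refine key (fun j => -(Complex.arg (p (j + 1) / p j) +
      Complex.arg ((p (j + 1) - c) / (p j - c))))
      (fun j => by linarith [(abs_le.mp (hp j).abs_arg_add_arg_le).1]) ?_ j
    rw [Finset.sum_neg_distrib, Finset.sum_add_distrib, a, b]
    ring

/-! ### Points on two unit circles -/

/-- The sixth root of unity `exp (i π / 3)`. -/
noncomputable def hexRoot : ℂ := Complex.exp ((Real.pi / 3 : ℝ) * Complex.I)

theorem hexRoot_re : hexRoot.re = 1 / 2 := by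
  rw [hexRoot, Complex.exp_ofReal_mul_I_re, Real.cos_pi_div_three]

theorem hexRoot_im : hexRoot.im = √3 / 2 := by
  rw [hexRoot, Complex.exp_ofReal_mul_I_im, Real.sin_pi_div_three]

theorem sqrt_three_mul_self : √3 * √3 = 3 := Real.mul_self_sqrt (by norm_num)

theorem hexRoot_sq : hexRoot ^ 2 = hexRoot - 1 := by
  have := sqrt_three_mul_self
  apply Complex.ext
  · simp only [sq, Complex.mul_re, Complex.sub_re, hexRoot_re, hexRoot_im, Complex.one_re]
    linarith
  · simp only [sq, Complex.mul_im, Complex.sub_im, hexRoot_re, hexRoot_im, Complex.one_im]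
    ring

theorem norm_hexRoot : ‖hexRoot‖ = 1 := Complex.norm_exp_ofReal_mul_I _

theorem norm_eq_one_iff_sq {z : ℂ} : ‖z‖ = 1 ↔ z.re ^ 2 + z.im ^ 2 = 1 := by
  rw [← pow_eq_one_iff_of_nonneg (norm_nonneg z) two_ne_zero, Complex.sq_norm,
    Complex.normSq_apply, sq, sq]

theorem one_le_norm_iff_sq {z : ℂ} : 1 ≤ ‖z‖ ↔ 1 ≤ z.re ^ 2 + z.im ^ 2 := by
  rw [← one_le_sq_iff₀ (norm_nonneg z), Complex.sq_norm, Complex.normSq_apply, sq, sq]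

theorem one_le_norm_sub_one_iff {z : ℂ} (hz : ‖z‖ = 1) : 1 ≤ ‖z - 1‖ ↔ z.re ≤ 1 / 2 := by
  rw [norm_eq_one_iff_sq] at hz
  rw [one_le_norm_iff_sq]
  simp only [Complex.sub_re, Complex.sub_im, Complex.one_re, Complex.one_im]
  constructor <;> intro h <;> nlinarith

theorem one_le_norm_one_add_iff {z : ℂ} (hz : ‖z‖ = 1) : 1 ≤ ‖1 + z‖ ↔ -(1 / 2) ≤ z.re := by
  have := one_le_norm_sub_one_iff (z := -z) (by rwa [norm_neg])
  rw [← neg_add', norm_neg, add_comm, Complex.neg_re] at this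
  rw [this, neg_le]

/-- Two points of the unit circle at distance `1` differ by a rotation by `π / 3`. -/
theorem eq_mul_hexRoot {x y : ℂ} (hx : ‖x‖ = 1) (hy : ‖y‖ = 1) (hxy : ‖y - x‖ = 1)
    (him : 0 < (y / x).im) : y = x * hexRoot := by
  have hx0 : x ≠ 0 := norm_pos_iff.mp (by rw [hx]; norm_num)
  suffices y / x = hexRoot by rw [← this, mul_div_cancel₀ _ hx0]
  have h1 : ‖y / x‖ = 1 := by rw [norm_div, hx, hy, div_one]
  have h2 : ‖y / x - 1‖ = 1 := by rw [div_sub_one hx0, norm_div, hxy, hx, div_one]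
  generalize y / x = w at *
  rw [norm_eq_one_iff_sq] at h1 h2
  simp only [Complex.sub_re, Complex.sub_im, Complex.one_re, Complex.one_im] at h2
  have hre : w.re = 1 / 2 := by nlinarith
  have h3 := sqrt_three_mul_self
  apply Complex.ext
  · rw [hre, hexRoot_re]
  · rw [hexRoot_im]
    rw [hre] at h1
    have h4 : (w.im - √3 / 2) * (w.im + √3 / 2) = 0 := by nlinarith
    have h5 : 0 < w.im + √3 / 2 := by positivity
    linarith [(mul_eq_zero.mp h4).resolve_right h5.ne']

/-- A point of the unit circle about `0` and a point of the unit circle about `1` at distance `1`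
differ by a unit translation, unless one of them is the center of the other circle. -/
theorem eq_add_one_of_norm {e q : ℂ} (he : ‖e‖ = 1) (hq : ‖q - 1‖ = 1) (hd : ‖q - e‖ = 1)
    (he1 : e ≠ 1) (hq0 : q ≠ 0) : q = e + 1 := by
  obtain ⟨f, hf⟩ : ∃ f, f = q - 1 := ⟨_, rfl⟩
  have hqf : q = f + 1 := by rw [hf]; ring
  subst hqf
  rw [add_sub_cancel_right] at hq
  rw [norm_eq_one_iff_sq] at he hq hd
  simp only [Complex.sub_re, Complex.sub_im, Complex.add_re, Complex.add_im, Complex.one_re,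
    Complex.one_im, add_zero] at hd
  have hbd : (1 + f.re) * (1 - e.re) = f.im * e.im := by nlinarith
  have he2 : e.re ≠ 1 := fun h => he1 (Complex.ext h (by
    rw [h] at he
    have : e.im ^ 2 = 0 := by linarith
    simpa using this))
  have hf2 : f.re ≠ -1 := fun h => hq0 (Complex.ext (by simp [h]) (by
    rw [h] at hq
    have : f.im ^ 2 = 0 := by linarith
    simpa using this))
  have h1 : 1 + f.re ≠ 0 := fun h => hf2 (by linarith)
  have h2 : 1 - e.re ≠ 0 := fun h => he2 (by linarith)
  have hsq : ((1 + f.re) * (1 - e.re)) * (2 * (f.re - e.re)) = 0 := by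
    have h3 : ((1 + f.re) * (1 - e.re)) ^ 2 = f.im ^ 2 * e.im ^ 2 := by rw [hbd]; ring
    have h4 : f.im ^ 2 = (1 - f.re) * (1 + f.re) := by linarith
    have h5 : e.im ^ 2 = (1 - e.re) * (1 + e.re) := by linarith
    rw [h4, h5] at h3
    linear_combination h3
  have hre : f.re = e.re := by
    have := (mul_eq_zero.mp hsq).resolve_left (mul_ne_zero h1 h2)
    linarith
  have him : f.im = e.im := by
    rw [hre] at hbd h1
    have h6 : e.im * (f.im - e.im) = 0 := by nlinarith
    have h7 : e.im ≠ 0 := fun h => mul_ne_zero h1 h2 (by rw [hbd, h, mul_zero])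
    have := (mul_eq_zero.mp h6).resolve_left h7
    linarith
  rw [Complex.ext hre him]

theorem sqrt_three_div_two_le {a b : ℝ} (h : a ^ 2 + b ^ 2 = 1) (h1 : -(1 / 2) ≤ a)
    (h2 : a ≤ 1 / 2) (hb : 0 < b) : √3 / 2 ≤ b := by
  have h3 := sqrt_three_mul_self
  have h4 : √3 / 2 ≤ |b| := by
    apply Real.le_sqrt_of_sq_le _ |>.trans_eq (Real.sqrt_sq_eq_abs b)
    nlinarith
  rwa [abs_of_pos hb] at h4

theorem mul_hexRoot_re (e : ℂ) : (e * hexRoot).re = e.re / 2 - √3 / 2 * e.im := by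
  rw [Complex.mul_re, hexRoot_re, hexRoot_im]; ring

theorem mul_hexRoot_im (e : ℂ) : (e * hexRoot).im = √3 / 2 * e.re + e.im / 2 := by
  rw [Complex.mul_im, hexRoot_re, hexRoot_im]; ring

theorem eq_hexRoot_of_re {e : ℂ} (he : ‖e‖ = 1) (h1 : -(1 / 2) ≤ e.re) (h2 : e.re ≤ 1 / 2)
    (him : 0 < e.im) (h3 : -(1 / 2) ≤ (e * hexRoot).re) : e = hexRoot := by
  have hs := sqrt_three_div_two_le (norm_eq_one_iff_sq.mp he) h1 h2 him
  have h4 := sqrt_three_mul_self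
  have h5 : 0 < √3 := by positivity
  rw [mul_hexRoot_re] at h3
  have h6 : e.im ≤ √3 / 2 := by nlinarith
  have h7 : e.im = √3 / 2 := le_antisymm h6 hs
  apply Complex.ext
  · rw [hexRoot_re]
    rw [h7] at h3
    nlinarith
  · rw [h7, hexRoot_im]

theorem eq_hexRoot_sub_one_of_re {e : ℂ} (he : ‖e‖ = 1) (h1 : -(1 / 2) ≤ e.re)
    (h2 : e.re ≤ 1 / 2) (him : 0 < e.im) (h3 : -(1 / 2) ≤ (e * (hexRoot - 1)).re) :
    e = hexRoot - 1 := by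
  have hs := sqrt_three_div_two_le (norm_eq_one_iff_sq.mp he) h1 h2 him
  have h4 := sqrt_three_mul_self
  have h5 : 0 < √3 := by positivity
  rw [mul_sub, mul_one, Complex.sub_re, mul_hexRoot_re] at h3
  have h6 : e.im ≤ √3 / 2 := by nlinarith
  have h7 : e.im = √3 / 2 := le_antisymm h6 hs
  apply Complex.ext
  · rw [Complex.sub_re, hexRoot_re, Complex.one_re]
    rw [h7] at h3
    nlinarith
  · rw [h7, Complex.sub_im, hexRoot_im, Complex.one_im, sub_zero]

/-! ### Tight octagons -/

theorem forall_zmod_eight {P : ZMod 8 → Prop} (h : P 0 ∧ P 1 ∧ P 2 ∧ P 3 ∧ P 4 ∧ P 5 ∧ P 6 ∧ P 7) :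
    ∀ j, P j := by
  obtain ⟨h0, h1, h2, h3, h4, h5, h6, h7⟩ := h
  intro j
  fin_cases j <;> assumption

/-- The closed octagons with unit edges that occur in the equality case, in the coordinate in which
the centers of `C₁` and `C₂` are `0` and `1`: the vertices are at distance at least `1` from each
other and from `0` and `1`, each is at distance `1` from `0` or `1`, and all edges turn
counterclockwise around both points. -/
structure IsTightOctagon (p : ZMod 8 → ℂ) : Prop where
  norm_succ_sub : ∀ j, ‖p (j + 1) - p j‖ = 1
  one_le_norm_sub : ∀ i j, i ≠ j → 1 ≤ ‖p i - p j‖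
  one_le_norm : ∀ j, 1 ≤ ‖p j‖
  one_le_norm_sub_one : ∀ j, 1 ≤ ‖p j - 1‖
  touch : ∀ j, ‖p j‖ = 1 ∨ ‖p j - 1‖ = 1
  turn_left : ∀ j, 0 < (p (j + 1) / p j).im
  turn_right : ∀ j, 0 < ((p (j + 1) - 1) / (p j - 1)).im

/-- The vertices of the slid octagon whose first vertex is `e`: with `ω = exp (i π / 3)` they are
`e`, `e ω`, `e ω²`, `e ω³`, `1 + e ω³`, `1 + e ω⁴`, `1 + e ω⁵`, `1 + e ω⁶`, reduced by
`ω² = ω - 1`. -/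
noncomputable def slidPoint (e : ℂ) : ZMod 8 → ℂ :=
  (![e, e * hexRoot, e * (hexRoot - 1), -e, 1 - e, 1 - e * hexRoot, 1 - e * (hexRoot - 1), 1 + e] :
    Fin 8 → ℂ)

namespace IsTightOctagon

variable {p : ZMod 8 → ℂ}

theorem ne_of_ne (h : IsTightOctagon p) {i j : ZMod 8} (hij : i ≠ j) : p i ≠ p j := fun heq => by
  have := h.one_le_norm_sub i j hij
  rw [heq, sub_self, norm_zero] at this
  linarith

theorem ne_zero (h : IsTightOctagon p) (j : ZMod 8) : p j ≠ 0 :=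
  norm_pos_iff.mp (zero_lt_one.trans_le (h.one_le_norm j))

theorem ne_one (h : IsTightOctagon p) (j : ZMod 8) : p j ≠ 1 :=
  sub_ne_zero.mp (norm_pos_iff.mp (zero_lt_one.trans_le (h.one_le_norm_sub_one j)))

theorem shift (h : IsTightOctagon p) (a : ZMod 8) : IsTightOctagon fun j => p (a + j) where
  norm_succ_sub j := by simpa only [add_assoc] using h.norm_succ_sub (a + j)
  one_le_norm_sub i j hij := h.one_le_norm_sub _ _ fun heq => hij (add_left_cancel heq)
  one_le_norm j := h.one_le_norm _
  one_le_norm_sub_one j := h.one_le_norm_sub_one _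
  touch j := h.touch _
  turn_left j := by simpa only [add_assoc] using h.turn_left (a + j)
  turn_right j := by simpa only [add_assoc] using h.turn_right (a + j)

/-- From a vertex on the circle about `0` the octagon goes on by a rotation by `π / 3` about `0`,
or crosses over to the circle about `1` by a translation. -/
theorem succ_left (h : IsTightOctagon p) {j : ZMod 8} (hj : ‖p j‖ = 1) :
    p (j + 1) = p j * hexRoot ∨ (p (j + 1) = p j + 1 ∧ ‖p (j + 1) - 1‖ = 1) := by
  rcases h.touch (j + 1) with h1 | h1
  · exact Or.inl (eq_mul_hexRoot hj h1 (h.norm_succ_sub j) (h.turn_left j))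
  · exact Or.inr ⟨eq_add_one_of_norm hj h1 (h.norm_succ_sub j) (h.ne_one j) (h.ne_zero _), h1⟩

/-- The counterpart of `succ_left` for a vertex on the circle about `1`. -/
theorem succ_right (h : IsTightOctagon p) {j : ZMod 8} (hj : ‖p j - 1‖ = 1) :
    p (j + 1) = 1 + (p j - 1) * hexRoot ∨ (p (j + 1) = p j - 1 ∧ ‖p (j + 1)‖ = 1) := by
  rcases h.touch (j + 1) with h1 | h1
  · refine Or.inr ⟨?_, h1⟩
    have := eq_add_one_of_norm h1 hj (by rw [norm_sub_rev]; exact h.norm_succ_sub j) (h.ne_one _)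
      (h.ne_zero j)
    rw [this, add_sub_cancel_right]
  · left
    have := eq_mul_hexRoot hj h1 (by rw [sub_sub_sub_cancel_right]; exact h.norm_succ_sub j)
      (h.turn_right j)
    rw [← this]; ring

/-- Seven vertices in regular position on one circle are too many, as `ω ^ 6 = 1`. -/
theorem not_forall_rotate (h : IsTightOctagon p) (c : ℂ) :
    ¬ ∀ j, p (j + 1) - c = (p j - c) * hexRoot := by
  intro hall
  have hn : ∀ n : ℕ, p n - c = (p 0 - c) * hexRoot ^ n := by
    intro n
    induction n with
    | zero => simp
    | succ n ih => rw [Nat.cast_succ, hall, ih, pow_succ, mul_assoc]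
  have h6 : hexRoot ^ 6 = 1 := by
    have := hexRoot_sq
    linear_combination (hexRoot ^ 4 + hexRoot ^ 3 - hexRoot - 1) * this
  have := hn 6
  rw [h6, mul_one, sub_left_inj] at this
  exact h.ne_of_ne (by decide) this

/-- Somewhere the octagon crosses over from the circle about `1` to the circle about `0`. -/
theorem exists_crossing (h : IsTightOctagon p) : ∃ a, ‖p a‖ ≠ 1 ∧ ‖p (a + 1)‖ = 1 := by
  by_contra! hcon
  have hcon' : ∀ a, ‖p (a + 1)‖ = 1 → ‖p a‖ = 1 := fun a ha => by
    by_contra hne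
    exact hcon a hne ha
  by_cases hex : ∃ j, ‖p j‖ = 1
  · obtain ⟨j, hj⟩ := hex
    have hback : ∀ n : ℕ, ‖p (j - n)‖ = 1 := by
      intro n
      induction n with
      | zero => simpa using hj
      | succ n ih =>
        apply hcon'
        rwa [show j - ((n + 1 : ℕ) : ZMod 8) + 1 = j - n by push_cast; ring]
    have hall : ∀ i, ‖p i‖ = 1 := fun i => by
      have := hback (j - i).val
      rwa [ZMod.natCast_zmod_val, sub_sub_cancel] at this
    refine h.not_forall_rotate 0 fun i => ?_
    rw [sub_zero, sub_zero]
    exact eq_mul_hexRoot (hall i) (hall (i + 1)) (h.norm_succ_sub i) (h.turn_left i)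
  · push Not at hex
    have hall : ∀ i, ‖p i - 1‖ = 1 := fun i => (h.touch i).resolve_left (hex i)
    refine h.not_forall_rotate 1 fun i => ?_
    exact eq_mul_hexRoot (hall i) (hall (i + 1))
      (by rw [sub_sub_sub_cancel_right]; exact h.norm_succ_sub i) (h.turn_right i)

/-- A tight octagon labelled so that it crosses over from the circle about `1` to the circle about
`0` just before the vertex `0` is a slid octagon. -/
theorem eq_slidPoint_of_crossing (h : IsTightOctagon p) (h7 : ‖p 7‖ ≠ 1) (h0 : ‖p 0‖ = 1) :
    -(1 / 2) ≤ (p 0).re ∧ (p 0).re ≤ 1 / 2 ∧ 0 < (p 0).im ∧ ∀ j, p j = slidPoint (p 0) j := by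
  have hω := hexRoot_sq
  have h7' : ‖p 7 - 1‖ = 1 := (h.touch 7).resolve_left h7
  have e7 : p 7 = 1 + p 0 := by
    have := h.norm_succ_sub 7
    rw [show (7 : ZMod 8) + 1 = 0 by decide, norm_sub_rev] at this
    rw [eq_add_one_of_norm h0 h7' this (h.ne_one 0) (h.ne_zero 7), add_comm]
  have hre2 : (p 0).re ≤ 1 / 2 := (one_le_norm_sub_one_iff h0).mp (h.one_le_norm_sub_one 0)
  have hre1 : -(1 / 2) ≤ (p 0).re :=
    (one_le_norm_one_add_iff h0).mp (by rw [← e7]; exact h.one_le_norm 7)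
  have n1 : ‖p 0 * hexRoot‖ = 1 := by rw [norm_mul, h0, norm_hexRoot, one_mul]
  have n2 : ‖p 0 * (hexRoot - 1)‖ = 1 := by
    rw [← hω, norm_mul, norm_pow, h0, norm_hexRoot, one_pow, one_mul]
  have e1 : p 1 = p 0 * hexRoot := by
    rcases h.succ_left h0 with h1 | ⟨h1, -⟩
    · exact h1
    · refine (h.ne_of_ne (i := 1) (j := 7) (by decide) ?_).elim
      rw [e7, add_comm, ← h1]; rfl
  have him : 0 < (p 0).im := by
    by_contra! hle
    have hne : (p 0).im ≠ 0 := fun h' => by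
      have := norm_eq_one_iff_sq.mp h0
      rw [h'] at this
      nlinarith
    have hlt : (p 0).im < 0 := lt_of_le_of_ne hle hne
    -- the vertex `1` would coincide with the vertex `7`
    have hr : (p 0 * hexRoot).re ≤ 1 / 2 :=
      (one_le_norm_sub_one_iff n1).mp (by rw [← e1]; exact h.one_le_norm_sub_one 1)
    have hneg : -p 0 = hexRoot := by
      refine eq_hexRoot_of_re (by rwa [norm_neg]) ?_ ?_ ?_ ?_
      · rw [Complex.neg_re]; linarith
      · rw [Complex.neg_re]; linarith
      · rw [Complex.neg_im]; linarith
      · rw [neg_mul, Complex.neg_re]; linarith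
    refine h.ne_of_ne (i := 1) (j := 7) (by decide) ?_
    rw [e1, e7, ← neg_neg (p 0), hneg]
    linear_combination -hω
  -- In each step the octagon either turns by `π / 3` or crosses over.  The wrong alternative is
  -- excluded by the distances or forces `p 0` to be a corner, where both alternatives agree or an
  -- earlier vertex would be met again.
  have e2 : p 2 = p 0 * (hexRoot - 1) := by
    rcases h.succ_left (j := 1) (by rw [e1]; exact n1) with h1 | ⟨h1, -⟩
    · rw [show (2 : ZMod 8) = 1 + 1 by decide, h1, e1]
      linear_combination p 0 * hω
    · rw [show (1 : ZMod 8) + 1 = 2 by decide, e1] at h1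
      have := eq_hexRoot_of_re h0 hre1 hre2 him ((one_le_norm_one_add_iff n1).mp (by
        rw [add_comm, ← h1]; exact h.one_le_norm 2))
      refine (h.ne_of_ne (i := 2) (j := 0) (by decide) ?_).elim
      rw [h1, this]
      linear_combination hω
  have e3 : p 3 = -p 0 := by
    rcases h.succ_left (j := 2) (by rw [e2]; exact n2) with h1 | ⟨h1, -⟩
    · rw [show (3 : ZMod 8) = 2 + 1 by decide, h1, e2]
      linear_combination p 0 * hω
    · rw [show (2 : ZMod 8) + 1 = 3 by decide, e2] at h1
      have := eq_hexRoot_sub_one_of_re h0 hre1 hre2 him ((one_le_norm_one_add_iff n2).mp (by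
        rw [add_comm, ← h1]; exact h.one_le_norm 3))
      rw [h1, this]
      linear_combination hω
  have e4 : p 4 = 1 - p 0 := by
    rcases h.succ_left (j := 3) (by rw [e3, norm_neg]; exact h0) with h1 | ⟨h1, -⟩
    · rw [show (3 : ZMod 8) + 1 = 4 by decide, e3, neg_mul] at h1
      have hr := (one_le_norm_sub_one_iff (by rw [norm_neg]; exact n1)).mp
        (h1 ▸ h.one_le_norm_sub_one 4)
      rw [Complex.neg_re] at hr
      have := eq_hexRoot_of_re h0 hre1 hre2 him (by linarith)
      rw [h1, this]
      linear_combination -hω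
    · rw [show (3 : ZMod 8) + 1 = 4 by decide, e3] at h1
      rw [h1]; ring
  have e5 : p 5 = 1 - p 0 * hexRoot := by
    rcases h.succ_right (j := 4) (by rw [e4, sub_sub_cancel_left, norm_neg]; exact h0)
      with h1 | ⟨h1, -⟩
    · rw [show (5 : ZMod 8) = 4 + 1 by decide, h1, e4]; ring
    · refine (h.ne_of_ne (i := 5) (j := 3) (by decide) ?_).elim
      rw [show (5 : ZMod 8) = 4 + 1 by decide, h1, e4, e3]; ring
  have e6 : p 6 = 1 - p 0 * (hexRoot - 1) := by
    rcases h.succ_right (j := 5) (by rw [e5, sub_sub_cancel_left, norm_neg]; exact n1)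
      with h1 | ⟨h1, -⟩
    · rw [show (6 : ZMod 8) = 5 + 1 by decide, h1, e5]
      linear_combination -p 0 * hω
    · rw [show (5 : ZMod 8) + 1 = 6 by decide, e5, sub_sub_cancel_left] at h1
      have hr := (one_le_norm_sub_one_iff (by rw [norm_neg]; exact n1)).mp
        (h1 ▸ h.one_le_norm_sub_one 6)
      rw [Complex.neg_re] at hr
      have := eq_hexRoot_of_re h0 hre1 hre2 him (by linarith)
      refine (h.ne_of_ne (i := 6) (j := 4) (by decide) ?_).elim
      rw [h1, e4, this]
      linear_combination -hω
  exact ⟨hre1, hre2, him, forall_zmod_eight ⟨rfl, e1, e2, e3, e4, e5, e6, e7⟩⟩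

end IsTightOctagon

theorem cos_two_mul_pi_div_three : Real.cos (2 * Real.pi / 3) = -(1 / 2) := by
  rw [show 2 * Real.pi / 3 = Real.pi - Real.pi / 3 by ring, Real.cos_pi_sub,
    Real.cos_pi_div_three]

/-- A point of the unit circle with positive imaginary part and real part in `[-1/2, 1/2]` has an
argument between `π / 3` and `2π / 3`. -/
theorem exists_angle {e : ℂ} (he : ‖e‖ = 1) (h1 : -(1 / 2) ≤ e.re) (h2 : e.re ≤ 1 / 2)
    (him : 0 < e.im) : ∃ θ ∈ Set.Icc (Real.pi / 3) (2 * Real.pi / 3),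
      Complex.exp ((θ : ℝ) * Complex.I) = e := by
  have he0 : e ≠ 0 := norm_pos_iff.mp (by rw [he]; norm_num)
  have hcos := Complex.cos_arg he0
  rw [he, div_one] at hcos
  have hpos := Complex.arg_nonneg_iff.mpr him.le
  have hπ := Real.pi_pos
  refine ⟨e.arg, ⟨?_, ?_⟩, ?_⟩
  · by_contra! hlt
    have := Real.cos_lt_cos_of_nonneg_of_le_pi hpos (by linarith) hlt
    rw [hcos, Real.cos_pi_div_three] at this
    linarith
  · by_contra! hlt
    have := Real.cos_lt_cos_of_nonneg_of_le_pi (by linarith) (Complex.arg_le_pi e) hlt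
    rw [hcos, cos_two_mul_pi_div_three] at this
    linarith
  · have := Complex.norm_mul_exp_arg_mul_I e
    rwa [he, Complex.ofReal_one, one_mul] at this

/-- Up to a shift of the labels every tight octagon is a slid octagon. -/
theorem IsTightOctagon.exists_eq_slidPoint {p : ZMod 8 → ℂ} (h : IsTightOctagon p) :
    ∃ θ ∈ Set.Icc (Real.pi / 3) (2 * Real.pi / 3), ∃ s : ZMod 8,
      ∀ j, p j = slidPoint (Complex.exp ((θ : ℝ) * Complex.I)) (s + j) := by
  obtain ⟨a, ha, ha'⟩ := h.exists_crossing
  have h0 : ‖p (a + 1 + 0)‖ = 1 := by rwa [add_zero]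
  obtain ⟨h1, h2, h3, hp⟩ := (h.shift (a + 1)).eq_slidPoint_of_crossing
    (by rwa [add_assoc, show (1 : ZMod 8) + 7 = 0 by decide, add_zero]) h0
  obtain ⟨θ, hθ, hexp⟩ := exists_angle h0 h1 h2 h3
  refine ⟨θ, hθ, -(a + 1), fun j => ?_⟩
  rw [hexp, ← hp, add_neg_cancel_left]

/-! ### The slid octagons are tight -/

theorem slidPoint_add_four (e : ℂ) : ∀ j, slidPoint e (j + 4) = 1 - slidPoint e j := by
  refine forall_zmod_eight ⟨rfl, rfl, rfl, ?_, ?_, ?_, ?_, ?_⟩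
  · exact (sub_neg_eq_add 1 e).symm
  · exact (sub_sub_cancel 1 e).symm
  · exact (sub_sub_cancel 1 (e * hexRoot)).symm
  · exact (sub_sub_cancel 1 (e * (hexRoot - 1))).symm
  · exact show -e = 1 - (1 + e) by ring

/-- Coordinates in the basis `1`, `ω` of the first four vertices of the slid octagon, up to the
rotation by `e`. -/
def slidCoord : Fin 4 → ℤ × ℤ := ![(1, 0), (0, 1), (-1, 1), (-1, 0)]

/-- The first four vertices of the slid octagon. -/
noncomputable def slidHalf (e : ℂ) (i : Fin 4) : ℂ :=
  e * ((slidCoord i).1 + (slidCoord i).2 * hexRoot)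

theorem slidPoint_eq (e : ℂ) : ∀ j : ZMod 8,
    (∃ i : Fin 4, j.val = i.val ∧ slidPoint e j = slidHalf e i) ∨
      (∃ i : Fin 4, j.val = i.val + 4 ∧ slidPoint e j = 1 - slidHalf e i) := by
  refine forall_zmod_eight ⟨Or.inl ⟨0, rfl, ?_⟩, Or.inl ⟨1, rfl, ?_⟩, Or.inl ⟨2, rfl, ?_⟩,
    Or.inl ⟨3, rfl, ?_⟩, Or.inr ⟨0, rfl, ?_⟩, Or.inr ⟨1, rfl, ?_⟩, Or.inr ⟨2, rfl, ?_⟩,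
    Or.inr ⟨3, rfl, ?_⟩⟩
  · show e = _; simp [slidHalf, slidCoord]
  · show e * hexRoot = _; simp [slidHalf, slidCoord]
  · show e * (hexRoot - 1) = _; rw [slidHalf, show slidCoord 2 = (-1, 1) from rfl]; push_cast; ring
  · show -e = _; simp [slidHalf, slidCoord]
  · show 1 - e = _; simp [slidHalf, slidCoord]
  · show 1 - e * hexRoot = _; simp [slidHalf, slidCoord]
  · show 1 - e * (hexRoot - 1) = _; rw [slidHalf, show slidCoord 2 = (-1, 1) from rfl]; push_cast; ring
  · show 1 + e = _; simp [slidHalf, slidCoord]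

theorem norm_sq_add_mul_hexRoot (a b : ℝ) : ‖(a + b * hexRoot : ℂ)‖ ^ 2 = a ^ 2 + a * b + b ^ 2 := by
  have h3 := sqrt_three_mul_self
  rw [Complex.sq_norm, Complex.normSq_apply]
  simp only [Complex.add_re, Complex.add_im, Complex.mul_re, Complex.mul_im, Complex.ofReal_re,
    Complex.ofReal_im, hexRoot_re, hexRoot_im]
  linear_combination (b ^ 2 / 4) * h3

theorem im_div_pos_iff {z w : ℂ} (hw : w ≠ 0) :
    0 < (z / w).im ↔ 0 < z.im * w.re - z.re * w.im := by
  have : (z / w).im = (z.im * w.re - z.re * w.im) / Complex.normSq w := by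
    rw [Complex.div_im]; ring
  rw [this, div_pos_iff_of_pos_right (Complex.normSq_pos.mpr hw)]

/-- The points `e` at which a slid octagon can start: `e = exp (i θ)` with
`π / 3 ≤ θ ≤ 2π / 3`. -/
structure IsSlidStart (e : ℂ) : Prop where
  norm_eq : ‖e‖ = 1
  neg_half_le_re : -(1 / 2) ≤ e.re
  re_le_half : e.re ≤ 1 / 2
  im_pos : 0 < e.im

namespace IsSlidStart

variable {e : ℂ}

theorem sqrt_three_div_two_le_im (h : IsSlidStart e) : √3 / 2 ≤ e.im :=
  sqrt_three_div_two_le (norm_eq_one_iff_sq.mp h.norm_eq) h.neg_half_le_re h.re_le_half h.im_pos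

theorem three_halves_le (h : IsSlidStart e) : 3 / 2 ≤ √3 * e.im := by
  have h1 := sqrt_three_mul_self
  have h2 : 0 < √3 := by positivity
  nlinarith [h.sqrt_three_div_two_le_im]

theorem norm_mul_sq (h : IsSlidStart e) (a b : ℤ) :
    ‖e * (a + b * hexRoot)‖ ^ 2 = ((a ^ 2 + a * b + b ^ 2 : ℤ) : ℝ) := by
  have := norm_sq_add_mul_hexRoot a b
  push_cast at this ⊢
  rw [norm_mul, h.norm_eq, one_mul, this]

/-- A sufficient criterion, in integers, for a point of the rotated hexagonal lattice to be at
distance at least `1` from `1`. -/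
theorem one_le_norm_mul_sub_one (h : IsSlidStart e) {a b : ℤ} (hb : 0 ≤ b)
    (hab : |2 * a + b| ≤ 3 * b + 2 * (a ^ 2 + a * b + b ^ 2)) :
    1 ≤ ‖e * (a + b * hexRoot) - 1‖ := by
  have hn := h.norm_mul_sq a b
  have h1 := h.neg_half_le_re
  have h2 := h.re_le_half
  have ht := h.three_halves_le
  have hre : 2 * (e * (a + b * hexRoot)).re = (2 * a + b) * e.re - b * (√3 * e.im) := by
    rw [show e * ((a : ℂ) + b * hexRoot) = ((a : ℝ) : ℂ) * e + ((b : ℝ) : ℂ) * (e * hexRoot) by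
      push_cast; ring, Complex.add_re, Complex.re_ofReal_mul, Complex.re_ofReal_mul,
      mul_hexRoot_re]
    ring
  have hab' : |2 * (a : ℝ) + b| ≤ 3 * b + 2 * (a ^ 2 + a * b + b ^ 2) := by exact_mod_cast hab
  have hb' : (0 : ℝ) ≤ b := by exact_mod_cast hb
  have hmul : (2 * (a : ℝ) + b) * e.re ≤ |2 * (a : ℝ) + b| * (1 / 2) := by
    refine (le_abs_self _).trans ?_
    rw [abs_mul]
    exact mul_le_mul_of_nonneg_left (abs_le.mpr ⟨h1, h2⟩) (abs_nonneg _)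
  have hle : 2 * (e * (a + b * hexRoot)).re ≤ ‖e * (a + b * hexRoot)‖ ^ 2 := by
    rw [hre, hn]
    push_cast
    nlinarith [mul_le_mul_of_nonneg_left ht hb']
  rw [one_le_norm_iff_sq]
  rw [Complex.sq_norm, Complex.normSq_apply] at hle
  simp only [Complex.sub_re, Complex.sub_im, Complex.one_re, Complex.one_im]
  nlinarith

theorem norm_slidHalf (h : IsSlidStart e) (i : Fin 4) : ‖slidHalf e i‖ = 1 := by
  rw [← pow_eq_one_iff_of_nonneg (norm_nonneg _) two_ne_zero, slidHalf, h.norm_mul_sq]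
  have : ∀ i : Fin 4, (slidCoord i).1 ^ 2 + (slidCoord i).1 * (slidCoord i).2 +
      (slidCoord i).2 ^ 2 = 1 := by decide
  exact_mod_cast this i

theorem one_le_norm_slidHalf_sub_one (h : IsSlidStart e) (i : Fin 4) :
    1 ≤ ‖slidHalf e i - 1‖ := by
  have h1 : ∀ i, 0 ≤ (slidCoord i).2 := by decide
  have h2 : ∀ i, |2 * (slidCoord i).1 + (slidCoord i).2| ≤ 3 * (slidCoord i).2 +
      2 * ((slidCoord i).1 ^ 2 + (slidCoord i).1 * (slidCoord i).2 + (slidCoord i).2 ^ 2) := by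
    decide
  exact h.one_le_norm_mul_sub_one (h1 i) (h2 i)

theorem one_le_norm_slidHalf_sub (h : IsSlidStart e) {i j : Fin 4} (hij : i ≠ j) :
    1 ≤ ‖slidHalf e i - slidHalf e j‖ := by
  have h1 : ∀ i j : Fin 4, i ≠ j → 1 ≤ ((slidCoord i).1 - (slidCoord j).1) ^ 2 +
      ((slidCoord i).1 - (slidCoord j).1) * ((slidCoord i).2 - (slidCoord j).2) +
      ((slidCoord i).2 - (slidCoord j).2) ^ 2 := by decide
  have h2 := h.norm_mul_sq ((slidCoord i).1 - (slidCoord j).1) ((slidCoord i).2 - (slidCoord j).2)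
  rw [← one_le_sq_iff₀ (norm_nonneg _), show slidHalf e i - slidHalf e j =
    e * (((slidCoord i).1 - (slidCoord j).1 : ℤ) + ((slidCoord i).2 - (slidCoord j).2 : ℤ) *
      hexRoot) by simp only [slidHalf]; push_cast; ring, h2]
  exact_mod_cast h1 i j hij

theorem one_le_norm_slidHalf_add_sub_one (h : IsSlidStart e) (i j : Fin 4) :
    1 ≤ ‖slidHalf e i + slidHalf e j - 1‖ := by
  have h1 : ∀ i j : Fin 4, 0 ≤ (slidCoord i).2 + (slidCoord j).2 := by decide
  have h2 : ∀ i j : Fin 4, |2 * ((slidCoord i).1 + (slidCoord j).1) +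
      ((slidCoord i).2 + (slidCoord j).2)| ≤ 3 * ((slidCoord i).2 + (slidCoord j).2) +
      2 * (((slidCoord i).1 + (slidCoord j).1) ^ 2 +
        ((slidCoord i).1 + (slidCoord j).1) * ((slidCoord i).2 + (slidCoord j).2) +
        ((slidCoord i).2 + (slidCoord j).2) ^ 2) := by decide
  have := h.one_le_norm_mul_sub_one (h1 i j) (h2 i j)
  rwa [show slidHalf e i + slidHalf e j =
    e * (((slidCoord i).1 + (slidCoord j).1 : ℤ) + ((slidCoord i).2 + (slidCoord j).2 : ℤ) *
      hexRoot) by simp only [slidHalf]; push_cast; ring]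

theorem isTightOctagon (h : IsSlidStart e) : IsTightOctagon (slidPoint e) := by
  have hω := hexRoot_sq
  have hs := sqrt_three_mul_self
  have hs0 : 0 < √3 := by positivity
  have hx1 := h.neg_half_le_re
  have hx2 := h.re_le_half
  have hy := h.im_pos
  have hxy := norm_eq_one_iff_sq.mp h.norm_eq
  have hnorm : ∀ j, 1 ≤ ‖slidPoint e j‖ := by
    intro j
    rcases slidPoint_eq e j with ⟨i, -, hi⟩ | ⟨i, -, hi⟩
    · rw [hi, h.norm_slidHalf]
    · rw [hi, norm_sub_rev]; exact h.one_le_norm_slidHalf_sub_one i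
  have hne : ∀ j, slidPoint e j ≠ 0 := fun j =>
    norm_pos_iff.mp (zero_lt_one.trans_le (hnorm j))
  have hturn : ∀ j, 0 < (slidPoint e (j + 1) / slidPoint e j).im := by
    have him := mul_hexRoot_im e
    have hre := mul_hexRoot_re e
    intro j
    rw [im_div_pos_iff (hne j)]
    revert j
    refine forall_zmod_eight ⟨?_, ?_, ?_, ?_, ?_, ?_, ?_, ?_⟩
    -- the numerators of the imaginary parts, one edge after the other
    · show 0 < (e * hexRoot).im * e.re - (e * hexRoot).re * e.im
      rw [him, hre]; nlinarith
    · show 0 < (e * (hexRoot - 1)).im * (e * hexRoot).re - (e * (hexRoot - 1)).re * (e * hexRoot).im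
      rw [mul_sub, mul_one, Complex.sub_im, Complex.sub_re, him, hre]; nlinarith
    · show 0 < (-e).im * (e * (hexRoot - 1)).re - (-e).re * (e * (hexRoot - 1)).im
      rw [mul_sub, mul_one, Complex.sub_im, Complex.sub_re, Complex.neg_im, Complex.neg_re, him, hre]
      nlinarith
    · show 0 < (1 - e).im * (-e).re - (1 - e).re * (-e).im
      simp only [Complex.sub_im, Complex.sub_re, Complex.neg_im, Complex.neg_re, Complex.one_re,
        Complex.one_im]
      nlinarith
    · show 0 < (1 - e * hexRoot).im * (1 - e).re - (1 - e * hexRoot).re * (1 - e).im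
      simp only [Complex.sub_im, Complex.sub_re, him, hre, Complex.one_re, Complex.one_im]
      nlinarith
    · show 0 < (1 - e * (hexRoot - 1)).im * (1 - e * hexRoot).re -
        (1 - e * (hexRoot - 1)).re * (1 - e * hexRoot).im
      simp only [mul_sub, mul_one, Complex.sub_im, Complex.sub_re, him, hre, Complex.one_re,
        Complex.one_im]
      nlinarith
    · show 0 < (1 + e).im * (1 - e * (hexRoot - 1)).re - (1 + e).re * (1 - e * (hexRoot - 1)).im
      simp only [mul_sub, mul_one, Complex.sub_im, Complex.sub_re, Complex.add_im, Complex.add_re,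
        him, hre, Complex.one_re, Complex.one_im]
      nlinarith
    · show 0 < e.im * (1 + e).re - e.re * (1 + e).im
      simp only [Complex.add_im, Complex.add_re, Complex.one_re, Complex.one_im]
      nlinarith
  refine ⟨?_, ?_, hnorm, ?_, ?_, hturn, ?_⟩
  · have n0 : ‖e‖ = 1 := h.norm_eq
    have n1 : ‖e * hexRoot‖ = 1 := by rw [norm_mul, n0, norm_hexRoot, one_mul]
    have n2 : ‖e * hexRoot - e‖ = 1 := by
      rw [show e * hexRoot - e = e * hexRoot ^ 2 by rw [hω]; ring, norm_mul, norm_pow, n0,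
        norm_hexRoot, one_pow, one_mul]
    have key : ∀ j, ‖slidPoint e (j + 4 + 1) - slidPoint e (j + 4)‖ =
        ‖slidPoint e (j + 1) - slidPoint e j‖ := fun j => by
      rw [add_right_comm, slidPoint_add_four, slidPoint_add_four, sub_sub_sub_cancel_left,
        norm_sub_rev]
    have k0 : ‖slidPoint e (0 + 1) - slidPoint e 0‖ = 1 := n2
    have k1 : ‖slidPoint e (1 + 1) - slidPoint e 1‖ = 1 := by
      show ‖e * (hexRoot - 1) - e * hexRoot‖ = 1
      rw [show e * (hexRoot - 1) - e * hexRoot = -e by ring, norm_neg, n0]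
    have k2 : ‖slidPoint e (2 + 1) - slidPoint e 2‖ = 1 := by
      show ‖-e - e * (hexRoot - 1)‖ = 1
      rw [show -e - e * (hexRoot - 1) = -(e * hexRoot) by ring, norm_neg, n1]
    have k3 : ‖slidPoint e (3 + 1) - slidPoint e 3‖ = 1 := by
      show ‖1 - e - -e‖ = 1
      simp
    exact forall_zmod_eight ⟨k0, k1, k2, k3, (key 0).trans k0, (key 1).trans k1,
      (key 2).trans k2, (key 3).trans k3⟩
  · intro i j hij
    have hval : i.val ≠ j.val := fun hv => hij (ZMod.val_injective 8 hv)
    rcases slidPoint_eq e i with ⟨a, ha, hi⟩ | ⟨a, ha, hi⟩ <;>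
      rcases slidPoint_eq e j with ⟨b, hb, hj⟩ | ⟨b, hb, hj⟩ <;> rw [hi, hj]
    · exact h.one_le_norm_slidHalf_sub fun hab => hval (by rw [ha, hb, hab])
    · rw [← sub_add, sub_add_eq_add_sub]
      exact h.one_le_norm_slidHalf_add_sub_one a b
    · rw [norm_sub_rev, ← sub_add, sub_add_eq_add_sub]
      exact h.one_le_norm_slidHalf_add_sub_one b a
    · rw [sub_sub_sub_cancel_left]
      exact h.one_le_norm_slidHalf_sub fun hab => hval (by rw [ha, hb, hab])
  · intro j
    rw [norm_sub_rev, ← slidPoint_add_four]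
    exact hnorm _
  · intro j
    rcases slidPoint_eq e j with ⟨i, -, hi⟩ | ⟨i, -, hi⟩
    · exact Or.inl (by rw [hi, h.norm_slidHalf])
    · exact Or.inr (by rw [hi, sub_sub_cancel_left, norm_neg, h.norm_slidHalf])
  · intro j
    have := hturn (j + 4)
    rw [add_right_comm, slidPoint_add_four, slidPoint_add_four] at this
    rwa [← neg_div_neg_eq, neg_sub, neg_sub]

end IsSlidStart

theorem isSlidStart_exp {θ : ℝ} (hθ : θ ∈ Set.Icc (Real.pi / 3) (2 * Real.pi / 3)) :
    IsSlidStart (Complex.exp ((θ : ℝ) * Complex.I)) := by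
  have hπ := Real.pi_pos
  obtain ⟨h1, h2⟩ := hθ
  refine ⟨Complex.norm_exp_ofReal_mul_I θ, ?_, ?_, ?_⟩
  · rw [Complex.exp_ofReal_mul_I_re, ← cos_two_mul_pi_div_three]
    exact Real.cos_le_cos_of_nonneg_of_le_pi (by linarith) (by linarith) h2
  · rw [Complex.exp_ofReal_mul_I_re, ← Real.cos_pi_div_three]
    exact Real.cos_le_cos_of_nonneg_of_le_pi (by linarith) (by linarith) h1
  · rw [Complex.exp_ofReal_mul_I_im]
    exact Real.sin_pos_of_pos_of_lt_pi (by linarith) (by linarith)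

/-- Unless its first vertex is the corner with real part `-1/2`, a slid octagon has no other vertex
that could be the first vertex of such an octagon. -/
theorem eq_of_eq_slidPoint {e e' : ℂ} (h : IsSlidStart e) (h' : IsSlidStart e')
    (hre : -(1 / 2) < e.re) (hre' : -(1 / 2) < e'.re) :
    ∀ j, e = slidPoint e' j → e = e' := by
  have hs0 : 0 < √3 := by positivity
  have h1 := h.im_pos
  have h2 := h.re_le_half
  have h3 := h'.im_pos
  have h4 := h'.re_le_half
  have h5 := h'.three_halves_le
  have h6 := h'.sqrt_three_div_two_le_im
  have him := mul_hexRoot_im e'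
  have hrw := mul_hexRoot_re e'
  refine forall_zmod_eight ⟨id, fun h => ?_, fun h => ?_, fun h => ?_, fun h => ?_, fun h => ?_,
    fun h => ?_, fun h => ?_⟩ <;> exfalso
  · have := congrArg Complex.re (h.trans (show _ = e' * hexRoot from rfl))
    linarith
  · have := congrArg Complex.re (h.trans (show _ = e' * (hexRoot - 1) from rfl))
    rw [mul_sub, mul_one, Complex.sub_re] at this
    linarith
  · have := congrArg Complex.im (h.trans (show _ = -e' from rfl))
    rw [Complex.neg_im] at this
    linarith
  · have := congrArg Complex.im (h.trans (show _ = 1 - e' from rfl))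
    rw [Complex.sub_im, Complex.one_im] at this
    linarith
  · have := congrArg Complex.im (h.trans (show _ = 1 - e' * hexRoot from rfl))
    rw [Complex.sub_im, Complex.one_im, him] at this
    nlinarith
  · have := congrArg Complex.re (h.trans (show _ = 1 - e' * (hexRoot - 1) from rfl))
    rw [mul_sub, mul_one, Complex.sub_re, Complex.sub_re, Complex.one_re] at this
    linarith
  · have := congrArg Complex.re (h.trans (show _ = 1 + e' from rfl))
    rw [Complex.add_re, Complex.one_re] at this
    linarith

/-- The six vectors of norm `1` in the hexagonal lattice. -/
theorem eq_of_sq_add_mul_add_sq_eq_one {m n : ℤ} (h : m ^ 2 + m * n + n ^ 2 = 1) :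
    (m = 1 ∧ n = 0) ∨ (m = 0 ∧ n = 1) ∨ (m = -1 ∧ n = 1) ∨ (m = -1 ∧ n = 0) ∨
      (m = 0 ∧ n = -1) ∨ (m = 1 ∧ n = -1) := by
  have hn1 : n ≤ 1 := by nlinarith [sq_nonneg (2 * m + n)]
  have hn2 : -1 ≤ n := by nlinarith [sq_nonneg (2 * m + n)]
  have hm1 : m ≤ 1 := by nlinarith [sq_nonneg (2 * n + m)]
  have hm2 : -1 ≤ m := by nlinarith [sq_nonneg (2 * n + m)]
  interval_cases m <;> interval_cases n <;> simp_all

/-- The vertices of the slid octagon that starts at `ω` are the points of the hexagonal lattice at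
distance `1` from `0` or `1`, other than `0` and `1`. -/
theorem mem_range_slidPoint_hexRoot_iff {z : ℂ} :
    z ∈ Set.range (slidPoint hexRoot) ↔ (∃ m n : ℤ, z = m + n * hexRoot) ∧ z ≠ 0 ∧ z ≠ 1 ∧
      (‖z‖ = 1 ∨ ‖z - 1‖ = 1) := by
  have hω := hexRoot_sq
  have hstart : IsSlidStart hexRoot :=
    ⟨norm_hexRoot, by rw [hexRoot_re]; norm_num, hexRoot_re.le, by rw [hexRoot_im]; positivity⟩
  have ht := hstart.isTightOctagon
  have v0 : slidPoint hexRoot 0 = hexRoot := rfl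
  have v1 : slidPoint hexRoot 1 = hexRoot - 1 := by
    rw [← hω, sq]; rfl
  have v2 : slidPoint hexRoot 2 = -1 := by
    show hexRoot * (hexRoot - 1) = -1
    linear_combination hω
  have v3 : slidPoint hexRoot 3 = -hexRoot := rfl
  have v4 : slidPoint hexRoot 4 = 1 - hexRoot := rfl
  have v5 : slidPoint hexRoot 5 = 2 - hexRoot := by
    show 1 - hexRoot * hexRoot = _
    linear_combination -hω
  have v6 : slidPoint hexRoot 6 = 2 := by
    show 1 - hexRoot * (hexRoot - 1) = _
    linear_combination -hω
  have v7 : slidPoint hexRoot 7 = 1 + hexRoot := rfl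
  have hnorm : ∀ a b : ℤ, ‖(a + b * hexRoot : ℂ)‖ = 1 → a ^ 2 + a * b + b ^ 2 = 1 := by
    intro a b hab
    have := norm_sq_add_mul_hexRoot a b
    push_cast at this
    rw [hab, one_pow] at this
    exact_mod_cast this.symm
  constructor
  · rintro ⟨j, rfl⟩
    refine ⟨?_, ht.ne_zero j, ht.ne_one j, ht.touch j⟩
    revert j
    refine forall_zmod_eight ⟨⟨0, 1, ?_⟩, ⟨-1, 1, ?_⟩, ⟨-1, 0, ?_⟩, ⟨0, -1, ?_⟩, ⟨1, -1, ?_⟩,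
      ⟨2, -1, ?_⟩, ⟨2, 0, ?_⟩, ⟨1, 1, ?_⟩⟩
    · rw [v0]; push_cast; ring
    · rw [v1]; push_cast; ring
    · rw [v2]; push_cast; ring
    · rw [v3]; push_cast; ring
    · rw [v4]; push_cast; ring
    · rw [v5]; push_cast; ring
    · rw [v6]; push_cast; ring
    · rw [v7]; push_cast; ring
  · rintro ⟨⟨m, n, rfl⟩, hz0, hz1, hz | hz⟩
    · rcases eq_of_sq_add_mul_add_sq_eq_one (hnorm m n hz) with ⟨rfl, rfl⟩ | ⟨rfl, rfl⟩ |
        ⟨rfl, rfl⟩ | ⟨rfl, rfl⟩ | ⟨rfl, rfl⟩ | ⟨rfl, rfl⟩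
      · simp at hz1
      · exact ⟨0, by rw [v0]; push_cast; ring⟩
      · exact ⟨1, by rw [v1]; push_cast; ring⟩
      · exact ⟨2, by rw [v2]; push_cast; ring⟩
      · exact ⟨3, by rw [v3]; push_cast; ring⟩
      · exact ⟨4, by rw [v4]; push_cast; ring⟩
    · obtain ⟨m, rfl⟩ : ∃ l, m = l + 1 := ⟨m - 1, by ring⟩
      rw [show (((m + 1 : ℤ) : ℂ) + n * hexRoot - 1) = m + n * hexRoot by push_cast; ring] at hz
      rcases eq_of_sq_add_mul_add_sq_eq_one (hnorm m n hz) with ⟨rfl, rfl⟩ | ⟨rfl, rfl⟩ |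
        ⟨rfl, rfl⟩ | ⟨rfl, rfl⟩ | ⟨rfl, rfl⟩ | ⟨rfl, rfl⟩
      · exact ⟨6, by rw [v6]; push_cast; ring⟩
      · exact ⟨7, by rw [v7]; push_cast; ring⟩
      · exact ⟨0, by rw [v0]; push_cast; ring⟩
      · simp at hz0
      · exact ⟨4, by rw [v4]; push_cast; ring⟩
      · exact ⟨5, by rw [v5]; push_cast; ring⟩

/-! ### Necklaces and polygons -/

section Necklace

variable {C₁ C₂ : Horoball}

theorem norm_sq_tie {k : ℕ} {N : ZMod k → Horoball} (hN : IsNecklace N) (j : ZMod k) :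
    ‖(N (j + 1)).center - (N j).center‖ ^ 2 = 4 * (N j).radius * (N (j + 1)).radius := by
  rw [norm_sub_rev]
  exact Horoball.tangent_iff.mp (hN.tangent_succ j)

/-- In an encircling necklace a tie is the shortest of the segments between its ends and the
centers of `C₁` and `C₂`. -/
theorem IsEncirclingNecklace.isShortSegment {k : ℕ} [NeZero k] {N : ZMod k → Horoball}
    (hN : IsEncirclingNecklace C₁ C₂ N) (h₁ : C₁.IsFull) (h₂ : C₂.IsFull)
    (hd : C₁.InteriorDisjoint C₂) (j : ZMod k) :
    IsShortSegment ((N (j + 1)).center - C₁.center) ((N j).center - C₁.center)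
      (C₂.center - C₁.center) := by
  have htie := norm_sq_tie hN.isNecklace j
  have r0 := (N j).radius_pos
  have r1 := (N (j + 1)).radius_pos
  have s0 : (N j).radius ≤ 1 / 2 := hN.isAtMostFull j
  have s1 : (N (j + 1)).radius ≤ 1 / 2 := hN.isAtMostFull (j + 1)
  have hle : ∀ {z : ℂ}, ‖(N (j + 1)).center - (N j).center‖ ^ 2 ≤ ‖z‖ ^ 2 →
      ‖(N (j + 1)).center - (N j).center‖ ≤ ‖z‖ := fun h =>
    (pow_le_pow_iff_left₀ (norm_nonneg _) (norm_nonneg _) two_ne_zero).mp h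
  have hl := fun i => Horoball.interiorDisjoint_iff.mp (hN.interiorDisjoint_left i)
  have hr := fun i => Horoball.interiorDisjoint_iff.mp (hN.interiorDisjoint_right i)
  unfold Horoball.IsFull at h₁ h₂
  simp only [h₁] at hl
  simp only [h₂] at hr
  refine ⟨fun heq => ?_, ?_, ?_, ?_, ?_, ?_⟩
  · rw [sub_left_inj] at heq
    rw [heq, sub_self, norm_zero] at htie
    nlinarith [mul_pos r0 r1]
  all_goals
    rw [sub_sub_sub_cancel_right]
  · exact hle (by nlinarith [hl (j + 1)])
  · exact hle (by nlinarith [hl j])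
  · rw [sub_sub_sub_cancel_right]; exact hle (by nlinarith [hr (j + 1)])
  · rw [sub_sub_sub_cancel_right]; exact hle (by nlinarith [hr j])
  · have := (Horoball.interiorDisjoint_of_isFull h₁ h₂).mp hd
    rw [norm_sub_rev] at this
    exact hle (by nlinarith)

theorem Encircles.sum_ne_zero {k : ℕ} [NeZero k] {N : ZMod k → Horoball} {C : Horoball}
    (h : Encircles N C) :
    ∑ j, Complex.arg (((N (j + 1)).center - C.center) / ((N j).center - C.center)) ≠ 0 :=
  fun h0 => h (by unfold tieWinding; rw [h0, zero_div])

theorem IsEncirclingNecklace.sum_right_ne_zero {k : ℕ} [NeZero k] {N : ZMod k → Horoball}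
    (hN : IsEncirclingNecklace C₁ C₂ N) :
    ∑ j, Complex.arg (((N (j + 1)).center - C₁.center - (C₂.center - C₁.center)) /
      ((N j).center - C₁.center - (C₂.center - C₁.center))) ≠ 0 := by
  simpa only [sub_sub_sub_cancel_right] using hN.encircles_right.sum_ne_zero

theorem slidNecklace_eq (θ : ℝ) (j : ZMod 8) : slidNecklace C₁ C₂ θ j =
    Horoball.full (C₁.center + (C₂.center - C₁.center) *
      slidPoint (Complex.exp ((θ : ℝ) * Complex.I)) j) := by
  have hω := hexRoot_sq
  have hexp : ∀ n : ℕ, Complex.exp ((θ + n * (Real.pi / 3) : ℝ) * Complex.I) =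
      Complex.exp ((θ : ℝ) * Complex.I) * hexRoot ^ n := by
    intro n
    rw [hexRoot, ← Complex.exp_nat_mul, ← Complex.exp_add]
    congr 1
    push_cast
    ring
  unfold slidNecklace
  congr 1
  have left : ∀ n : ℕ, n ≤ 3 → ∀ i : ZMod 8, i.val = n →
      (if i.val ≤ 3 then C₁.center + (C₂.center - C₁.center) *
        Complex.exp ((θ + i.val * (Real.pi / 3) : ℝ) * Complex.I)
      else C₂.center + (C₂.center - C₁.center) *
        Complex.exp ((θ + ((i.val : ℝ) - 1) * (Real.pi / 3) : ℝ) * Complex.I)) =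
      C₁.center + (C₂.center - C₁.center) *
        (Complex.exp ((θ : ℝ) * Complex.I) * hexRoot ^ n) := by
    intro n hn i hi
    rw [hi, if_pos hn, hexp]
  have right : ∀ n : ℕ, 3 ≤ n → ∀ i : ZMod 8, i.val = n + 1 →
      (if i.val ≤ 3 then C₁.center + (C₂.center - C₁.center) *
        Complex.exp ((θ + i.val * (Real.pi / 3) : ℝ) * Complex.I)
      else C₂.center + (C₂.center - C₁.center) *
        Complex.exp ((θ + ((i.val : ℝ) - 1) * (Real.pi / 3) : ℝ) * Complex.I)) =
      C₁.center + (C₂.center - C₁.center) *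
        (1 + Complex.exp ((θ : ℝ) * Complex.I) * hexRoot ^ n) := by
    intro n hn i hi
    rw [hi, if_neg (by omega), Nat.cast_succ, add_sub_cancel_right, hexp]
    ring
  have h3 : hexRoot ^ 3 = -1 := by linear_combination (hexRoot + 1) * hω
  have h4 : hexRoot ^ 4 = -hexRoot := by linear_combination hexRoot * h3
  have h5 : hexRoot ^ 5 = 1 - hexRoot := by linear_combination hexRoot * h4 - hω
  have h6 : hexRoot ^ 6 = 1 := by linear_combination (hexRoot ^ 3 - 1) * h3
  generalize Complex.exp ((θ : ℝ) * Complex.I) = e at *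
  revert j
  refine forall_zmod_eight ⟨(left 0 (by norm_num) 0 rfl).trans ?_,
    (left 1 (by norm_num) 1 rfl).trans ?_, (left 2 (by norm_num) 2 rfl).trans ?_,
    (left 3 (by norm_num) 3 rfl).trans ?_, (right 3 (by norm_num) 4 rfl).trans ?_,
    (right 4 (by norm_num) 5 rfl).trans ?_, (right 5 (by norm_num) 6 rfl).trans ?_,
    (right 6 (by norm_num) 7 rfl).trans ?_⟩ <;> congr 2
  · show _ = e
    ring
  · show _ = e * hexRoot
    ring
  · show _ = e * (hexRoot - 1)
    rw [hω]
  · show _ = -e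
    rw [h3]; ring
  · show _ = 1 - e
    rw [h3]; ring
  · show _ = 1 - e * hexRoot
    rw [h4]; ring
  · show _ = 1 - e * (hexRoot - 1)
    rw [h5]; ring
  · show _ = 1 + e
    rw [h6, mul_one]

/-- What the equality case says about a necklace with eight beads. -/
theorem IsEncirclingNecklace.rigid {N : ZMod 8 → Horoball} (hN : IsEncirclingNecklace C₁ C₂ N)
    (h₁ : C₁.IsFull) (h₂ : C₂.IsFull) (hd : C₁.InteriorDisjoint C₂) :
    ‖C₂.center - C₁.center‖ = 1 ∧ (∀ j, (N j).IsFull) ∧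
      ∀ j, ‖(N j).center - C₁.center‖ = 1 ∨ ‖(N j).center - C₂.center‖ = 1 := by
  have hs := hN.isShortSegment h₁ h₂ hd
  have heq : ∀ j, ‖C₂.center - C₁.center‖ = ‖(N (j + 1)).center - (N j).center‖ ∧
      (‖(N j).center - C₁.center‖ = ‖(N (j + 1)).center - (N j).center‖ ∨
        ‖(N j).center - C₂.center‖ = ‖(N (j + 1)).center - (N j).center‖) := by
    intro j
    have := (hs j).of_abs_arg_add_arg_eq (by
      have hπ := Real.pi_pos
      rcases arg_add_arg_eq_of_eight (c := C₂.center - C₁.center)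
        (p := fun j => (N j).center - C₁.center) hs hN.encircles_left.sum_ne_zero
        hN.sum_right_ne_zero with h | h
      · rw [h j, abs_of_pos (by positivity)]
      · rw [h j, abs_neg, abs_of_pos (by positivity)])
    simpa only [sub_sub_sub_cancel_right] using this
  have hc : 1 ≤ ‖C₂.center - C₁.center‖ := by
    rw [norm_sub_rev]; exact (Horoball.interiorDisjoint_of_isFull h₁ h₂).mp hd
  have hrad : ∀ j, (N j).radius = 1 / 2 := by
    intro j
    have htie := norm_sq_tie hN.isNecklace j
    rw [← (heq j).1] at htie
    have r0 := (N j).radius_pos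
    have s0 : (N j).radius ≤ 1 / 2 := hN.isAtMostFull j
    have s1 : (N (j + 1)).radius ≤ 1 / 2 := hN.isAtMostFull (j + 1)
    nlinarith
  have hone : ‖C₂.center - C₁.center‖ = 1 := by
    have htie := norm_sq_tie hN.isNecklace 0
    rw [← (heq 0).1, hrad, hrad] at htie
    rw [← pow_eq_one_iff_of_nonneg (norm_nonneg _) two_ne_zero, htie]
    norm_num
  refine ⟨hone, hrad, fun j => ?_⟩
  have := (heq j).2
  rwa [← (heq j).1, hone] at this

theorem im_pos_of_arg_pos {z : ℂ} (h0 : 0 < Complex.arg z) (h1 : Complex.arg z < Real.pi) :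
    0 < z.im := by
  refine lt_of_le_of_ne (Complex.arg_nonneg_iff.mp h0.le) fun h => ?_
  rcases lt_or_ge z.re 0 with hz | hz
  · exact h1.ne (Complex.arg_eq_pi_iff.mpr ⟨hz, h.symm⟩)
  · exact h0.ne' (Complex.arg_eq_zero_iff.mpr ⟨hz, h.symm⟩)

/-- The polygon of an encircling necklace with eight beads is a tight octagon, possibly after
reversal. -/
theorem IsEncirclingNecklace.isTightOctagon {N : ZMod 8 → Horoball}
    (hN : IsEncirclingNecklace C₁ C₂ N) (h₁ : C₁.IsFull) (h₂ : C₂.IsFull)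
    (hd : C₁.InteriorDisjoint C₂) :
    IsTightOctagon (fun j => ((N j).center - C₁.center) / (C₂.center - C₁.center)) ∨
      IsTightOctagon (fun j => ((N (-j)).center - C₁.center) / (C₂.center - C₁.center)) := by
  have hπ := Real.pi_pos
  have hs := hN.isShortSegment h₁ h₂ hd
  obtain ⟨hc, hfull, htouch⟩ := hN.rigid h₁ h₂ hd
  have hc0 : C₂.center - C₁.center ≠ 0 := norm_pos_iff.mp (by rw [hc]; norm_num)
  have hnorm : ∀ z : ℂ, ‖z / (C₂.center - C₁.center)‖ = ‖z‖ := fun z => by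
    rw [norm_div, hc, div_one]
  have hsub : ∀ z : ℂ, (z - C₁.center) / (C₂.center - C₁.center) - 1 =
      (z - C₂.center) / (C₂.center - C₁.center) := fun z => by
    field_simp; ring
  have hdiff : ∀ z w : ℂ, (z - C₁.center) / (C₂.center - C₁.center) -
      (w - C₁.center) / (C₂.center - C₁.center) = (z - w) / (C₂.center - C₁.center) := fun z w => by
    rw [← sub_div, sub_sub_sub_cancel_right]
  have hsucc : ∀ j, ‖(N (j + 1)).center - (N j).center‖ = 1 := fun j => by
    rw [norm_sub_rev]
    exact (Horoball.tangent_of_isFull (hfull j) (hfull (j + 1))).mp (hN.isNecklace.tangent_succ j)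
  have hsep : ∀ i j, i ≠ j → 1 ≤ ‖(N i).center - (N j).center‖ := fun i j hij =>
    (Horoball.interiorDisjoint_of_isFull (hfull i) (hfull j)).mp
      (hN.isNecklace.interiorDisjoint i j hij)
  have hl : ∀ j, 1 ≤ ‖(N j).center - C₁.center‖ := fun j =>
    (Horoball.interiorDisjoint_of_isFull (hfull j) h₁).mp (hN.interiorDisjoint_left j)
  have hr : ∀ j, 1 ≤ ‖(N j).center - C₂.center‖ := fun j =>
    (Horoball.interiorDisjoint_of_isFull (hfull j) h₂).mp (hN.interiorDisjoint_right j)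
  have hα := fun j => abs_le.mp (hs j).abs_arg_left
  have hβ := fun j => abs_le.mp (hs j).abs_arg_right
  have hidx : ∀ j : ZMod 8, -j = -(j + 1) + 1 := fun j => by ring
  rcases arg_add_arg_eq_of_eight (c := C₂.center - C₁.center)
    (p := fun j => (N j).center - C₁.center) hs hN.encircles_left.sum_ne_zero
    hN.sum_right_ne_zero with h | h
  · left
    simp only [sub_sub_sub_cancel_right] at h hβ
    refine ⟨fun j => ?_, fun i j hij => ?_, fun j => ?_, fun j => ?_, fun j => ?_, fun j => ?_,
      fun j => ?_⟩
    · rw [hdiff, hnorm, hsucc]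
    · rw [hdiff, hnorm]; exact hsep i j hij
    · rw [hnorm]; exact hl j
    · rw [hsub, hnorm]; exact hr j
    · rw [hsub, hnorm, hnorm]; exact htouch j
    · rw [div_div_div_cancel_right₀ hc0]
      exact im_pos_of_arg_pos (by linarith [h j, (hβ j).2]) (by linarith [(hα j).2])
    · rw [hsub, hsub, div_div_div_cancel_right₀ hc0]
      exact im_pos_of_arg_pos (by linarith [h j, (hα j).2]) (by linarith [(hβ j).2])
  · right
    simp only [sub_sub_sub_cancel_right] at h hβ
    -- reversing an edge inverts the quotient, hence changes the sign of its imaginary part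
    have him : ∀ z w : ℂ, Complex.arg (z / w) < 0 → 0 < (w / z).im := by
      intro z w hlt
      rw [Complex.arg_neg_iff] at hlt
      rw [← inv_div, Complex.inv_im]
      exact div_pos (neg_pos.mpr hlt) (Complex.normSq_pos.mpr fun h0 => by simp [h0] at hlt)
    refine ⟨fun j => ?_, fun i j hij => ?_, fun j => ?_, fun j => ?_, fun j => ?_, fun j => ?_,
      fun j => ?_⟩
    · rw [hdiff, hnorm, norm_sub_rev, hidx j, hsucc]
    · rw [hdiff, hnorm]; exact hsep _ _ (neg_injective.ne hij)
    · rw [hnorm]; exact hl _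
    · rw [hsub, hnorm]; exact hr _
    · rw [hsub, hnorm, hnorm]; exact htouch _
    · rw [div_div_div_cancel_right₀ hc0, hidx j]
      exact him _ _ (by linarith [h (-(j + 1)), (hβ (-(j + 1))).1])
    · rw [hsub, hsub, div_div_div_cancel_right₀ hc0, hidx j]
      exact him _ _ (by linarith [h (-(j + 1)), (hα (-(j + 1))).1])

/-- A tight octagon, placed so that `0` and `1` become the centers of `C₁` and `C₂`, is the polygon
of an encircling necklace. -/
theorem IsTightOctagon.isEncirclingNecklace {p : ZMod 8 → ℂ} (hp : IsTightOctagon p)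
    (h₁ : C₁.IsFull) (h₂ : C₂.IsFull) (hc : ‖C₂.center - C₁.center‖ = 1) :
    IsEncirclingNecklace C₁ C₂ fun j =>
      Horoball.full (C₁.center + (C₂.center - C₁.center) * p j) := by
  have hc0 : C₂.center - C₁.center ≠ 0 := norm_pos_iff.mp (by rw [hc]; norm_num)
  have hfull : ∀ z, (Horoball.full z).IsFull := fun z => rfl
  have e1 : ∀ z, C₁.center + (C₂.center - C₁.center) * z - C₁.center =
      (C₂.center - C₁.center) * z := fun z => by ring
  have e2 : ∀ z, C₁.center + (C₂.center - C₁.center) * z - C₂.center =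
      (C₂.center - C₁.center) * (z - 1) := fun z => by ring
  have e3 : ∀ z w, C₁.center + (C₂.center - C₁.center) * z -
      (C₁.center + (C₂.center - C₁.center) * w) = (C₂.center - C₁.center) * (z - w) :=
    fun z w => by ring
  have hnorm : ∀ z, ‖(C₂.center - C₁.center) * z‖ = ‖z‖ := fun z => by rw [norm_mul, hc, one_mul]
  have harg : ∀ z : ℂ, 0 < z.im → 0 < Complex.arg z := fun z hz =>
    lt_of_le_of_ne (Complex.arg_nonneg_iff.mpr hz.le) fun h =>
      hz.ne' (Complex.arg_eq_zero_iff.mp h.symm).2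
  have hdisj : ∀ i j, i ≠ j → (Horoball.full (C₁.center + (C₂.center - C₁.center) *
      p i)).InteriorDisjoint (Horoball.full (C₁.center + (C₂.center - C₁.center) * p j)) := by
    intro i j hij
    rw [Horoball.interiorDisjoint_of_isFull (hfull _) (hfull _)]
    show 1 ≤ ‖_ - (_ : ℂ)‖
    rw [Horoball.full, Horoball.full, e3, hnorm]
    exact hp.one_le_norm_sub i j hij
  refine ⟨⟨hdisj, fun j => ?_⟩, fun j => le_refl (1 / 2 : ℝ), fun j => ?_, fun j => ?_, ?_, ?_⟩
  · rw [Horoball.tangent_of_isFull (hfull _) (hfull _), Horoball.full, Horoball.full, e3, hnorm,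
      norm_sub_rev]
    exact hp.norm_succ_sub j
  · rw [Horoball.interiorDisjoint_of_isFull (hfull _) h₁, Horoball.full, e1, hnorm]
    exact hp.one_le_norm j
  · rw [Horoball.interiorDisjoint_of_isFull (hfull _) h₂, Horoball.full, e2, hnorm]
    exact hp.one_le_norm_sub_one j
  · refine (div_pos (Finset.sum_pos (fun j _ => ?_) Finset.univ_nonempty)
      (by positivity)).ne'
    simp only [Horoball.full]
    rw [e1, e1, mul_div_mul_left _ _ hc0]
    exact harg _ (hp.turn_left j)
  · refine (div_pos (Finset.sum_pos (fun j _ => ?_) Finset.univ_nonempty)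
      (by positivity)).ne'
    simp only [Horoball.full]
    rw [e2, e2, mul_div_mul_left _ _ hc0]
    exact harg _ (hp.turn_right j)

end Necklace

/-! ### The family of slid necklaces -/

theorem slidNecklace_injOn {C₁ C₂ : Horoball} (hc0 : C₂.center - C₁.center ≠ 0) :
    Set.InjOn (fun θ : ℝ => Set.range (slidNecklace C₁ C₂ θ))
      (Set.Ico (Real.pi / 3) (2 * Real.pi / 3)) := by
  intro θ hθ θ' hθ' heq
  have hπ := Real.pi_pos
  have hre : ∀ {t : ℝ}, t ∈ Set.Ico (Real.pi / 3) (2 * Real.pi / 3) →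
      -(1 / 2) < (Complex.exp ((t : ℝ) * Complex.I)).re := by
    intro t ht
    rw [Complex.exp_ofReal_mul_I_re, ← cos_two_mul_pi_div_three]
    exact Real.cos_lt_cos_of_nonneg_of_le_pi (by linarith [ht.1]) (by linarith) ht.2
  obtain ⟨j, hj⟩ : slidNecklace C₁ C₂ θ 0 ∈ Set.range (slidNecklace C₁ C₂ θ') := by
    have heq : Set.range (slidNecklace C₁ C₂ θ) = Set.range (slidNecklace C₁ C₂ θ') := heq
    rw [← heq]
    exact ⟨0, rfl⟩
  rw [slidNecklace_eq, slidNecklace_eq] at hj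
  have hpt := mul_left_cancel₀ hc0 (add_left_cancel (congrArg Horoball.center hj))
  have hexp := eq_of_eq_slidPoint (isSlidStart_exp ⟨hθ.1, hθ.2.le⟩)
    (isSlidStart_exp ⟨hθ'.1, hθ'.2.le⟩) (hre hθ) (hre hθ') j hpt.symm
  have hcos := congrArg Complex.re hexp
  rw [Complex.exp_ofReal_mul_I_re, Complex.exp_ofReal_mul_I_re] at hcos
  exact Real.injOn_cos ⟨by linarith [hθ.1], by linarith [hθ.2]⟩
    ⟨by linarith [hθ'.1], by linarith [hθ'.2]⟩ hcos

theorem range_slidNecklace_pi_div_three {C₁ C₂ : Horoball} (h₁ : C₁.IsFull) (h₂ : C₂.IsFull)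
    (hc : ‖C₂.center - C₁.center‖ = 1) :
    Set.range (slidNecklace C₁ C₂ (Real.pi / 3)) =
      {B | B ∈ hexPacking C₁ C₂ ∧ B ≠ C₁ ∧ B ≠ C₂ ∧ (B.Tangent C₁ ∨ B.Tangent C₂)} := by
  have hc0 : C₂.center - C₁.center ≠ 0 := norm_pos_iff.mp (by rw [hc]; norm_num)
  -- the correspondence between points `z` of the normalized plane and full-sized horoballs
  have hB : ∀ z : ℂ, (z ≠ 0 ∧ z ≠ 1 ∧ (‖z‖ = 1 ∨ ‖z - 1‖ = 1)) ↔
      (Horoball.full (C₁.center + (C₂.center - C₁.center) * z) ≠ C₁ ∧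
        Horoball.full (C₁.center + (C₂.center - C₁.center) * z) ≠ C₂ ∧
        ((Horoball.full (C₁.center + (C₂.center - C₁.center) * z)).Tangent C₁ ∨
          (Horoball.full (C₁.center + (C₂.center - C₁.center) * z)).Tangent C₂)) := by
    intro z
    have hfull : (Horoball.full (C₁.center + (C₂.center - C₁.center) * z)).IsFull := rfl
    rw [Horoball.tangent_of_isFull hfull h₁, Horoball.tangent_of_isFull hfull h₂]
    have e1 : (Horoball.full (C₁.center + (C₂.center - C₁.center) * z)).center - C₁.center =
        (C₂.center - C₁.center) * z := by simp only [Horoball.full]; ring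
    have e2 : (Horoball.full (C₁.center + (C₂.center - C₁.center) * z)).center - C₂.center =
        (C₂.center - C₁.center) * (z - 1) := by simp only [Horoball.full]; ring
    have hiff : ∀ {C : Horoball}, C.IsFull →
        (Horoball.full (C₁.center + (C₂.center - C₁.center) * z) = C ↔
          (Horoball.full (C₁.center + (C₂.center - C₁.center) * z)).center - C.center = 0) := by
      intro C hC
      rw [sub_eq_zero]
      exact ⟨fun h => by rw [h], fun h => Horoball.ext h hC.symm⟩
    rw [Ne, Ne, Ne, Ne, hiff h₁, hiff h₂, e1, e2, norm_mul, norm_mul, hc, one_mul, one_mul,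
      mul_eq_zero, mul_eq_zero, or_iff_right hc0, or_iff_right hc0, sub_eq_zero]
  ext B
  constructor
  · rintro ⟨j, rfl⟩
    rw [slidNecklace_eq]
    obtain ⟨⟨m, n, hmn⟩, hz⟩ := mem_range_slidPoint_hexRoot_iff.mp ⟨j, rfl⟩
    exact ⟨⟨m, n, congrArg (fun z => Horoball.full (C₁.center + (C₂.center - C₁.center) * z)) hmn⟩,
      (hB _).mp hz⟩
  · rintro ⟨⟨m, n, rfl⟩, hz⟩
    obtain ⟨j, hj⟩ := mem_range_slidPoint_hexRoot_iff.mpr ⟨⟨m, n, rfl⟩, (hB _).mpr hz⟩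
    refine ⟨j, ?_⟩
    rw [slidNecklace_eq]
    exact congrArg (fun z => Horoball.full (C₁.center + (C₂.center - C₁.center) * z)) hj

/-- A full-sized horoball is determined by its center in the coordinate in which the centers of
`C₁` and `C₂` are `0` and `1`. -/
theorem Horoball.IsFull.eq_of_div_eq {B C₁ C₂ : Horoball} (hB : B.IsFull)
    (hc0 : C₂.center - C₁.center ≠ 0) {z : ℂ}
    (h : (B.center - C₁.center) / (C₂.center - C₁.center) = z) :
    B = Horoball.full (C₁.center + (C₂.center - C₁.center) * z) := by
  refine Horoball.ext ?_ hB
  rw [← h, mul_div_cancel₀ _ hc0]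
  exact (add_sub_cancel _ _).symm

theorem mainTheorem1 :
    -- at least eight beads
    (∀ C₁ C₂ : Horoball, C₁.IsFull → C₂.IsFull → C₁.InteriorDisjoint C₂ →
      ∀ (k : ℕ) [NeZero k] (N : ZMod k → Horoball), IsEncirclingNecklace C₁ C₂ N → 8 ≤ k) ∧
    -- rigidity and classification for eight beads, up to rotating and reversing the labels
    (∀ C₁ C₂ : Horoball, C₁.IsFull → C₂.IsFull → C₁.InteriorDisjoint C₂ →
      ∀ N : ZMod 8 → Horoball, IsEncirclingNecklace C₁ C₂ N →
        C₁.Tangent C₂ ∧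
        (∀ j, (N j).IsFull) ∧
        (∀ j, (N j).Tangent C₁ ∨ (N j).Tangent C₂) ∧
        ∃ θ ∈ Set.Icc (Real.pi / 3) (2 * Real.pi / 3), ∃ s : ZMod 8,
          (∀ j, N j = slidNecklace C₁ C₂ θ (s + j)) ∨
          (∀ j, N j = slidNecklace C₁ C₂ θ (s - j))) ∧
    -- all slid configurations occur, they are a one-parameter family, and one is hexagonal
    (∀ C₁ C₂ : Horoball, C₁.IsFull → C₂.IsFull → C₁.Tangent C₂ →
      (∀ θ ∈ Set.Icc (Real.pi / 3) (2 * Real.pi / 3),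
        IsEncirclingNecklace C₁ C₂ (slidNecklace C₁ C₂ θ)) ∧
      Set.InjOn (fun θ : ℝ => Set.range (slidNecklace C₁ C₂ θ))
        (Set.Ico (Real.pi / 3) (2 * Real.pi / 3)) ∧
      Set.range (slidNecklace C₁ C₂ (Real.pi / 3)) =
        {B | B ∈ hexPacking C₁ C₂ ∧ B ≠ C₁ ∧ B ≠ C₂ ∧ (B.Tangent C₁ ∨ B.Tangent C₂)}) := by

  refine ⟨fun C₁ C₂ h₁ h₂ hd k _ N hN => ?_, fun C₁ C₂ h₁ h₂ hd N hN => ?_,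
    fun C₁ C₂ h₁ h₂ ht => ?_⟩
  · exact eight_le_of_winding (p := fun j => (N j).center - C₁.center)
      (hN.isShortSegment h₁ h₂ hd) hN.encircles_left.sum_ne_zero hN.sum_right_ne_zero
  · obtain ⟨hc, hfull, htouch⟩ := hN.rigid h₁ h₂ hd
    have hc0 : C₂.center - C₁.center ≠ 0 := norm_pos_iff.mp (by rw [hc]; norm_num)
    refine ⟨(Horoball.tangent_of_isFull h₁ h₂).mpr (by rwa [norm_sub_rev]), hfull,
      fun j => (htouch j).imp (Horoball.tangent_of_isFull (hfull j) h₁).mpr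
        (Horoball.tangent_of_isFull (hfull j) h₂).mpr, ?_⟩
    rcases hN.isTightOctagon h₁ h₂ hd with hp | hp
    · obtain ⟨θ, hθ, s, hs⟩ := hp.exists_eq_slidPoint
      refine ⟨θ, hθ, s, Or.inl fun j => ?_⟩
      rw [slidNecklace_eq]
      exact (hfull j).eq_of_div_eq hc0 (hs j)
    · obtain ⟨θ, hθ, s, hs⟩ := hp.exists_eq_slidPoint
      refine ⟨θ, hθ, s, Or.inr fun j => ?_⟩
      rw [slidNecklace_eq]
      have hj := hs (-j)
      rw [neg_neg, ← sub_eq_add_neg] at hj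
      exact (hfull j).eq_of_div_eq hc0 hj
  · have hc : ‖C₂.center - C₁.center‖ = 1 := by
      rw [norm_sub_rev]; exact (Horoball.tangent_of_isFull h₁ h₂).mp ht
    have hc0 : C₂.center - C₁.center ≠ 0 := norm_pos_iff.mp (by rw [hc]; norm_num)
    refine ⟨fun θ hθ => ?_, slidNecklace_injOn hc0, range_slidNecklace_pi_div_three h₁ h₂ hc⟩
    rw [show slidNecklace C₁ C₂ θ = _ from funext (slidNecklace_eq θ)]
    exact (isSlidStart_exp hθ).isTightOctagon.isEncirclingNecklace h₁ h₂ hc
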